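/- There are an algorithm in the comparison-addition model (a random access machine with unit-cost operations on integers of $\mathcal{O}(\lg n)$ bits, whose only operations on real numbers are copying, addition and comparison) and a constant $C$ such that the following holds. Let $G=(V,E)$ be a finite directed acyclic graph without parallel edges, with $n=|V|\ge 1$ vertices, $m=|E|$ edges and arbitrary (possibly negative) real edge lengths, given as a list of its edges with their lengths, and let $m^*$ be the number of edges of $G$ that are contained in at least one shortest path. On input $G$ the algorithm solves the all-pairs shortest path problem: it computes the distance from $u$ to $v$ for every pair of vertices $u,v$ such that $v$ is reachable from $u$, and a predecessor matrix, which contains for every such pair with $u\neq v$ the last but one vertex of a shortest path from $u$ to $v$ and which marks the pairs $u \ne v$ for which $v$ is not reachable from $u$. It uses $\Theta(n^2)$ space, i.e. it accesses at least $n^2/C$ and at most $Cn^2$ memory cells. If $n\ge 2$ and the underlying undirected graph of $G$ is connected, its running time is at most $C\,(m^* n + m\lg n)$, that is, $\mathcal{O}(m^*n+m\lg n)$; without the connectedness assumption its running time is at most $C\,((m^*+n)\,n + m\lg n)$. -/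

import Mathlib

namespace DagApsp

/-! ### Weighted directed graphs and shortest paths -/

/-- A finite directed graph without parallel edges on the vertex set `Fin n`, with arbitrary real
edge lengths.  The `m` edges are numbered `0, …, m - 1` in an arbitrary order. -/
structure WDigraph (n : ℕ) where
  m : ℕ
  src : Fin m → Fin n
  tgt : Fin m → Fin n
  len : Fin m → ℝ
  simple : ∀ e f : Fin m, src e = src f → tgt e = tgt f → e = f

namespace WDigraph

variable {n : ℕ} (G : WDigraph n)

/-- `G.IsPath u v p`: the list of edges `p` is a directed path from `u` to `v`.  Repeated vertices
are not excluded here; in an acyclic graph they cannot occur. -/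
inductive IsPath : Fin n → Fin n → List (Fin G.m) → Prop
  | nil (u : Fin n) : IsPath u u []
  | cons (e : Fin G.m) (v : Fin n) (p : List (Fin G.m)) :
      IsPath (G.tgt e) v p → IsPath (G.src e) v (e :: p)

/-- The length of a path is the sum of the lengths of its edges. -/
def pathLen (p : List (Fin G.m)) : ℝ := (p.map G.len).sum

/-- `p` is a path of minimum length from `u` to `v`. -/
def IsShortestPath (u v : Fin n) (p : List (Fin G.m)) : Prop :=
  G.IsPath u v p ∧ ∀ q, G.IsPath u v q → G.pathLen p ≤ G.pathLen q

/-- `v` can be reached from `u` along a directed path. -/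
def Reachable (u v : Fin n) : Prop := ∃ p, G.IsPath u v p

/-- There is no nonempty closed directed path. -/
def Acyclic : Prop := ∀ u p, G.IsPath u u p → p = []

/-- The underlying undirected graph is connected (any two vertices are joined by a sequence of
edges traversed in either direction). -/
def WeaklyConnected : Prop :=
  ∀ u v, Relation.EqvGen (fun a b => ∃ e, G.src e = a ∧ G.tgt e = b) u v

/-- `m*`, the number of edges that are contained in at least one shortest path. -/
noncomputable def mStar : ℕ :=
  Set.ncard {e : Fin G.m | ∃ u v p, G.IsShortestPath u v p ∧ e ∈ p}

end WDigraph

/-! ### The machine: a random access machine for the comparison-addition model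

Integers (indices, pointers, counters) live in integer registers and integer arrays, real numbers in
real registers and real arrays.  Integers can be added, subtracted (truncated at `0`), multiplied and
compared; real numbers can only be copied, added and compared.  An array cell is addressed by the
content of an integer register.  A program names finitely many registers and arrays. -/

/-- The contents of the registers and of the (one-dimensional) arrays. -/
structure State where
  ireg : ℕ → ℕ
  rreg : ℕ → ℝ
  iarr : ℕ → ℕ → ℕ
  rarr : ℕ → ℕ → ℝ

/-- Elementary instructions.  The arguments are numbers of registers or of arrays, except for the
literal `c` in `const`. -/
inductive Instr where
  /-- `ireg x := c` -/
  | const (x c : ℕ)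
  /-- `ireg x := ireg y` -/
  | move (x y : ℕ)
  /-- `ireg x := ireg y + ireg z` -/
  | add (x y z : ℕ)
  /-- `ireg x := ireg y - ireg z` -/
  | sub (x y z : ℕ)
  /-- `ireg x := ireg y * ireg z` -/
  | mul (x y z : ℕ)
  /-- `ireg x := iarr a [ireg y]` -/
  | load (x a y : ℕ)
  /-- `iarr a [ireg x] := ireg y` -/
  | store (a x y : ℕ)
  /-- `rreg p := rreg q` -/
  | rmove (p q : ℕ)
  /-- `rreg p := rreg q + rreg r` -/
  | radd (p q r : ℕ)
  /-- `rreg p := rarr a [ireg y]` -/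
  | rload (p a y : ℕ)
  /-- `rarr a [ireg x] := rreg p` -/
  | rstore (a x p : ℕ)

/-- The effect of an elementary instruction. -/
def Instr.exec (s : State) : Instr → State
  | .const x c => { s with ireg := Function.update s.ireg x c }
  | .move x y => { s with ireg := Function.update s.ireg x (s.ireg y) }
  | .add x y z => { s with ireg := Function.update s.ireg x (s.ireg y + s.ireg z) }
  | .sub x y z => { s with ireg := Function.update s.ireg x (s.ireg y - s.ireg z) }
  | .mul x y z => { s with ireg := Function.update s.ireg x (s.ireg y * s.ireg z) }
  | .load x a y => { s with ireg := Function.update s.ireg x (s.iarr a (s.ireg y)) }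
  | .store a x y =>
      { s with
        iarr := Function.update s.iarr a (Function.update (s.iarr a) (s.ireg x) (s.ireg y)) }
  | .rmove p q => { s with rreg := Function.update s.rreg p (s.rreg q) }
  | .radd p q r => { s with rreg := Function.update s.rreg p (s.rreg q + s.rreg r) }
  | .rload p a y => { s with rreg := Function.update s.rreg p (s.rarr a (s.ireg y)) }
  | .rstore a x p =>
      { s with
        rarr := Function.update s.rarr a (Function.update (s.rarr a) (s.ireg x) (s.rreg p)) }

/-- A memory cell: an array (integer or real) together with an index. -/
inductive Cell where
  | int (a i : ℕ)
  | real (a i : ℕ)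

/-- The memory cell that an elementary instruction reads or writes, if any. -/
def Instr.cell (s : State) : Instr → Option Cell
  | .load _ a y => some (.int a (s.ireg y))
  | .store a x _ => some (.int a (s.ireg x))
  | .rload _ a y => some (.real a (s.ireg y))
  | .rstore a x _ => some (.real a (s.ireg x))
  | _ => none

/-- Tests: comparisons of two integer registers or of two real registers. -/
inductive Test where
  | lt (x y : ℕ)
  | eq (x y : ℕ)
  | rlt (p q : ℕ)

/-- The truth value of a test. -/
def Test.holds (s : State) : Test → Prop
  | .lt x y => s.ireg x < s.ireg y
  | .eq x y => s.ireg x = s.ireg y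
  | .rlt p q => s.rreg p < s.rreg q

/-- Programs. -/
inductive Prog where
  | skip
  | instr (i : Instr)
  | seq (c d : Prog)
  | ite (b : Test) (c d : Prog)
  | loop (b : Test) (c : Prog)

/-- A configuration: the list of program pieces still to be executed, and the state. -/
abbrev Config := List Prog × State

open Classical in
/-- One step of a computation: it executes one elementary instruction or evaluates one test
(or unfolds a sequential composition).  A configuration with nothing left to execute is halted. -/
noncomputable def step : Config → Config
  | ([], s) => ([], s)
  | (.skip :: k, s) => (k, s)
  | (.instr i :: k, s) => (k, i.exec s)
  | (.seq c d :: k, s) => (c :: d :: k, s)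
  | (.ite b c d :: k, s) => if b.holds s then (c :: k, s) else (d :: k, s)
  | (.loop b c :: k, s) => if b.holds s then (c :: .loop b c :: k, s) else (k, s)

/-- The configuration after `t` steps of the program `P` started in the state `s`. -/
noncomputable def run (P : Prog) (s : State) (t : ℕ) : Config := step^[t] ([P], s)

/-- The program has halted after (at most) `t` steps. -/
def HaltsIn (P : Prog) (s : State) (t : ℕ) : Prop := (run P s t).1 = []

/-- The memory cell accessed by the next step, if any. -/
def Config.cell : Config → Option Cell
  | (.instr i :: _, s) => i.cell s
  | _ => none

/-- The space used in the first `t` steps: the number of distinct memory cells read or written. -/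
noncomputable def space (P : Prog) (s : State) (t : ℕ) : ℕ :=
  Set.ncard {c : Cell | ∃ i < t, Config.cell (run P s i) = some c}

/-- All integers in the registers and in the memory are smaller than `B`. -/
def State.IntsBelow (s : State) (B : ℕ) : Prop :=
  (∀ x, s.ireg x < B) ∧ ∀ a i, s.iarr a i < B

/-! ### Input and output of the all-pairs shortest path problem -/

/-- The initial state for the input graph `G`: integer registers `0` and `1` hold the numbers of
vertices and of edges, cell `e` of integer array `0`, of integer array `1` and of real array `0` hold
the source, the target and the length of the edge `e`.  Everything else is `0`. -/
noncomputable def inputState {n : ℕ} (G : WDigraph n) : State where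
  ireg x := if x = 0 then n else if x = 1 then G.m else 0
  rreg _ := 0
  iarr a i :=
    if h : i < G.m then
      if a = 0 then (G.src ⟨i, h⟩ : ℕ) else if a = 1 then (G.tgt ⟨i, h⟩ : ℕ) else 0
    else 0
  rarr a i := if h : i < G.m then (if a = 0 then G.len ⟨i, h⟩ else 0) else 0

/-- The output is correct: real array `1` and integer array `2` hold, row by row, the distance matrix
and the predecessor matrix of `G`.  If `v` is reachable from `u`, then the entries at `(u, v)` are the
length of a shortest path from `u` to `v` and the number (plus one) of the last but one vertex on such
a path; the predecessor entry is `0` if the path is empty (`u = v`) or if `v` is not reachable. -/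
def CorrectOutput {n : ℕ} (G : WDigraph n) (s : State) : Prop :=
  ∀ u v : Fin n,
    (G.Reachable u v → ∃ p, G.IsShortestPath u v p ∧
      s.rarr 1 (u * n + v) = G.pathLen p ∧
      s.iarr 2 (u * n + v) = p.getLast?.elim 0 (fun e => (G.src e : ℕ) + 1)) ∧
    (¬ G.Reachable u v → s.iarr 2 (u * n + v) = 0)

end DagApsp

/-! The vertices are placed one by one in a topological order, and each new vertex `v` receives its
column of the two matrices. Only predecessors of `v` matter for this column, and their own columns
are already final. The edges `(w, v)` are treated with the latest source `w` first. When `(w, v)`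
comes up, every other in-neighbour of `v` reachable from `w` has been treated, so the current entry
at `(w, v)` describes the best path from `w` to `v` that does not use this edge.

If the edge is not shorter than that entry, then in every path that ends with it the edge can be
replaced by the known path from `w` to `v`. It is dropped for all start vertices at once, after a
single comparison (`IsEntry.insert_of_not_lt`). Otherwise the edge is itself a shortest path
(`IsEntry.mem_shortestEdges`), so the `n` relaxations it triggers are charged to one of the `m*`
edges. The bookkeeping, which includes scanning an `n × n` adjacency matrix in topological order
instead of sorting the in-edges, costs `O(n²)`. In total this is `O(n² + m* n)`, and the term `m lg
n` is not needed. In a weakly connected graph the edges on shortest paths already connect all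
vertices, so `n ≤ m* + 1` (`WeaklyConnected.le_mStar`) and `n²` is absorbed for `n ≥ 2`.

Correctness is phrased with `IsEntry` and `IsPathVia W`: treating the source `w` enlarges the set
`W` of admissible last-but-one vertices by `w`. `Wp` is a program logic that tracks time, word size
and accessed cells along with the state. The lower bound on space holds because every cell of the
adjacency matrix changes its content. -/

namespace DagApsp

/-! ### Weakest preconditions with running time, word size and accessed cells -/

section Wp

variable (B : ℕ) (A : Set Cell)

/-- The computation leads from `x` to `y` in `d` steps; on the way all integers are smaller than `B`
and all accessed cells belong to `A`. -/
def Reaches (x y : Config) (d : ℕ) : Prop :=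
  step^[d] x = y ∧ ∀ i < d, (step^[i] x).2.IntsBelow B ∧
    ∀ c, Config.cell (step^[i] x) = some c → c ∈ A

variable {B A}

theorem Reaches.trans {x y z : Config} {d e : ℕ} (h₁ : Reaches B A x y d)
    (h₂ : Reaches B A y z e) : Reaches B A x z (d + e) := by
  obtain ⟨rfl, h₁⟩ := h₁
  obtain ⟨rfl, h₂⟩ := h₂
  refine ⟨by rw [add_comm, Function.iterate_add_apply], fun i hi => ?_⟩
  rcases lt_or_ge i d with h | h
  · exact h₁ i h
  · obtain ⟨j, rfl⟩ := Nat.exists_eq_add_of_le h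
    have := h₂ j (by omega)
    rwa [← Function.iterate_add_apply, add_comm j d] at this

theorem Reaches.single {x : Config} (hx : x.2.IntsBelow B)
    (hc : ∀ c, Config.cell x = some c → c ∈ A) : Reaches B A x (step x) 1 := by
  refine ⟨rfl, fun i hi => ?_⟩
  obtain rfl : i = 0 := by omega
  exact ⟨hx, hc⟩

variable (B A)

/-- Started in the state `s` at time `t`, the program `c` terminates, and the final state and the
final time satisfy `Q`. -/
def Wp (c : Prog) (Q : State → ℕ → Prop) (s : State) (t : ℕ) : Prop :=
  s.IntsBelow B → ∃ s' d, (∀ k, Reaches B A (c :: k, s) (k, s') d) ∧ s'.IntsBelow B ∧ Q s' (t + d)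

/-- The side conditions for the execution of an elementary instruction. -/
def Instr.Safe (s : State) : Instr → Prop
  | .const _ c => c < B
  | .move _ _ => True
  | .add _ y z => s.ireg y + s.ireg z < B
  | .sub _ _ _ => True
  | .mul _ y z => s.ireg y * s.ireg z < B
  | .load _ a y => Cell.int a (s.ireg y) ∈ A
  | .store a x _ => Cell.int a (s.ireg x) ∈ A
  | .rmove _ _ => True
  | .radd _ _ _ => True
  | .rload _ a y => Cell.real a (s.ireg y) ∈ A
  | .rstore a x _ => Cell.real a (s.ireg x) ∈ A

variable {B A} {Q : State → ℕ → Prop} {s : State} {t : ℕ} {b : Test} {c d : Prog}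

theorem IntsBelow.update_ireg (h : s.IntsBelow B) {x v : ℕ} (hv : v < B) :
    State.IntsBelow { s with ireg := Function.update s.ireg x v } B := by
  refine ⟨fun y => ?_, h.2⟩
  by_cases hy : y = x
  · subst hy; simpa using hv
  · simpa [Function.update_of_ne hy] using h.1 y

theorem Instr.Safe.intsBelow {i : Instr} (hi : i.Safe B A s) (h : s.IntsBelow B) :
    (i.exec s).IntsBelow B := by
  cases i with
  | const x c => exact IntsBelow.update_ireg h hi
  | move x y => exact IntsBelow.update_ireg h (h.1 y)
  | add x y z => exact IntsBelow.update_ireg h hi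
  | sub x y z => exact IntsBelow.update_ireg h ((Nat.sub_le _ _).trans_lt (h.1 y))
  | mul x y z => exact IntsBelow.update_ireg h hi
  | load x a y => exact IntsBelow.update_ireg h (h.2 a _)
  | store a x y =>
    refine ⟨h.1, fun a' i => ?_⟩
    simp only [Instr.exec, Function.update_apply]
    have := h.1 y
    have := h.2 a i
    have := h.2 a' i
    split_ifs <;> simp_all [Function.update_apply]
    split_ifs <;> assumption
  | rmove p q => exact h
  | radd p q r => exact h
  | rload p a y => exact h
  | rstore a x p => exact h

theorem Instr.Safe.cell_mem {i : Instr} (hi : i.Safe B A s) {c : Cell} (hc : i.cell s = some c) :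
    c ∈ A := by
  cases i <;> simp_all [Instr.cell, Instr.Safe]

theorem Wp.mono {Q' : State → ℕ → Prop} (h : Wp B A c Q s t) (hQ : ∀ s t, Q s t → Q' s t) :
    Wp B A c Q' s t := fun hs =>
  let ⟨s', d, h₁, h₂, h₃⟩ := h hs
  ⟨s', d, h₁, h₂, hQ _ _ h₃⟩

theorem Wp.of_step {c' : List Prog} {s' : State} (hstep : ∀ k, step (c :: k, s) = (c' ++ k, s'))
    (hcell : ∀ k, Config.cell (c :: k, s) = none)
    (h : s.IntsBelow B → ∃ s'' d, (∀ k, Reaches B A (c' ++ k, s') (k, s'') d) ∧ s''.IntsBelow B ∧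
      Q s'' (t + 1 + d)) : Wp B A c Q s t := by
  intro hs
  obtain ⟨s'', d, h₁, h₂, h₃⟩ := h hs
  refine ⟨s'', 1 + d, fun k => ?_, h₂, by rwa [← add_assoc]⟩
  refine Reaches.trans (y := (c' ++ k, s')) ?_ (h₁ k)
  rw [← hstep]
  exact Reaches.single hs (by simp [hcell])

theorem Reaches.refl (x : Config) : Reaches B A x x 0 := ⟨rfl, by simp⟩

theorem Wp.skip (h : Q s (t + 1)) : Wp B A .skip Q s t :=
  Wp.of_step (c' := []) (s' := s) (fun _ => rfl) (fun _ => rfl) fun hs =>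
    ⟨s, 0, fun _ => Reaches.refl _, hs, h⟩

theorem Wp.instr {i : Instr} (hi : i.Safe B A s) (h : Q (i.exec s) (t + 1)) :
    Wp B A (.instr i) Q s t := fun hs =>
  ⟨i.exec s, 1, fun k => Reaches.single (x := (.instr i :: k, s)) hs fun _ hc => hi.cell_mem hc,
    hi.intsBelow hs, h⟩

/-- `Wp` quantifies over the rest `k` of the program. Running `c` with `d :: k` still to do is what
allows the two runs to be glued. The extra step pays for unfolding the composition. -/
theorem Wp.seq (h : Wp B A c (Wp B A d Q) s (t + 1)) : Wp B A (.seq c d) Q s t := by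
  refine Wp.of_step (c' := [c, d]) (s' := s) (fun _ => rfl) (fun _ => rfl) fun hs => ?_
  obtain ⟨s₁, d₁, h₁, hs₁, h⟩ := h hs
  obtain ⟨s₂, d₂, h₂, hs₂, h⟩ := h hs₁
  exact ⟨s₂, d₁ + d₂, fun k => (h₁ (d :: k)).trans (h₂ k), hs₂, by rwa [← add_assoc]⟩

theorem Wp.ite (h₁ : b.holds s → Wp B A c Q s (t + 1)) (h₂ : ¬ b.holds s → Wp B A d Q s (t + 1)) :
    Wp B A (.ite b c d) Q s t := by
  by_cases hb : b.holds s
  · exact Wp.of_step (c' := [c]) (s' := s) (fun _ => by simp [step, hb]) (fun _ => rfl) (h₁ hb)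
  · exact Wp.of_step (c' := [d]) (s' := s) (fun _ => by simp [step, hb]) (fun _ => rfl) (h₂ hb)

theorem Wp.loop_false (hb : ¬ b.holds s) (h : Q s (t + 1)) : Wp B A (.loop b c) Q s t :=
  Wp.of_step (c' := []) (s' := s) (fun _ => by simp [step, hb]) (fun _ => rfl) fun hs =>
    ⟨s, 0, fun _ => Reaches.refl _, hs, h⟩

theorem Wp.loop_true (hb : b.holds s) (h : Wp B A c (Wp B A (.loop b c) Q) s (t + 1)) :
    Wp B A (.loop b c) Q s t := by
  refine Wp.of_step (c' := [c, .loop b c]) (s' := s) (fun _ => by simp [step, hb]) (fun _ => rfl)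
    fun hs => ?_
  obtain ⟨s₁, d₁, h₁, hs₁, h⟩ := h hs
  obtain ⟨s₂, d₂, h₂, hs₂, h⟩ := h hs₁
  exact ⟨s₂, d₁ + d₂, fun k => (h₁ (_ :: k)).trans (h₂ k), hs₂, by rwa [← add_assoc]⟩

/-- The rule for a loop that is executed `N` times. -/
theorem Wp.loop (N : ℕ) (I : ℕ → State → ℕ → Prop) (h0 : I 0 s t)
    (hbody : ∀ k < N, ∀ s t, I k s t → b.holds s ∧ Wp B A c (I (k + 1)) s (t + 1))
    (hend : ∀ s t, I N s t → ¬ b.holds s ∧ Q s (t + 1)) : Wp B A (.loop b c) Q s t := by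
  -- Induction on the number `r` of iterations still to come.
  suffices H : ∀ r k, k + r = N → ∀ s t, I k s t → Wp B A (.loop b c) Q s t from
    H N 0 (by omega) s t h0
  intro r
  induction r with
  | zero =>
    rintro k rfl s t hI
    exact Wp.loop_false (hend s t hI).1 (hend s t hI).2
  | succ r ih =>
    intro k hk s t hI
    obtain ⟨hb, h⟩ := hbody k (by omega) s t hI
    exact Wp.loop_true hb (h.mono (ih (k + 1) (by omega)))

/-- A straight-line program. -/
def code : List Instr → Prog
  | [] => .skip
  | i :: l => .seq (.instr i) (code l)

variable (B A)

/-- The verification condition of a program; loops are left to `Wp`. -/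
def vc : Prog → (State → ℕ → Prop) → State → ℕ → Prop
  | .skip, Q, s, t => Q s (t + 1)
  | .instr i, Q, s, t => i.Safe B A s ∧ Q (i.exec s) (t + 1)
  | .seq c d, Q, s, t => vc c (vc d Q) s (t + 1)
  | .ite b c d, Q, s, t => (b.holds s → vc c Q s (t + 1)) ∧ (¬ b.holds s → vc d Q s (t + 1))
  | .loop b c, Q, s, t => Wp B A (.loop b c) Q s t

variable {B A}

theorem vc_mono {Q' : State → ℕ → Prop} (hQ : ∀ s t, Q s t → Q' s t) (h : vc B A c Q s t) :
    vc B A c Q' s t := by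
  induction c generalizing Q Q' s t with
  | skip => exact hQ _ _ h
  | instr i => exact ⟨h.1, hQ _ _ h.2⟩
  | seq c d ihc ihd => exact ihc (fun _ _ => ihd hQ) h
  | ite b c d ihc ihd => exact ⟨fun hb => ihc hQ (h.1 hb), fun hb => ihd hQ (h.2 hb)⟩
  | loop b c => exact Wp.mono h hQ

/-- Since `vc` is defined by recursion on the program, loop-free code can be unfolded by `simp` into
its side conditions and the final assertion. -/
theorem Wp.of_vc (h : vc B A c Q s t) : Wp B A c Q s t := by
  induction c generalizing Q s t with
  | skip => exact Wp.skip h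
  | instr i => exact Wp.instr h.1 h.2
  | seq c d ihc ihd => exact Wp.seq (ihc (vc_mono (fun _ _ => ihd) h))
  | ite b c d ihc ihd => exact Wp.ite (fun hb => ihc (h.1 hb)) (fun hb => ihd (h.2 hb))
  | loop b c => exact h

end Wp

/-- The halting run obtained from `Wp`. -/
theorem Wp.run {B : ℕ} {A : Set Cell} {P : Prog} {Q : State → ℕ → Prop} {s : State}
    (h : Wp B A P Q s 0) (hs : s.IntsBelow B) :
    ∃ T, HaltsIn P s T ∧ Q (DagApsp.run P s T).2 T ∧
      (∀ t ≤ T, (DagApsp.run P s t).2.IntsBelow B) ∧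
      {c | ∃ i < T, Config.cell (DagApsp.run P s i) = some c} ⊆ A := by
  obtain ⟨s', d, h₁, h₂, h₃⟩ := h hs
  obtain ⟨h₁, h₄⟩ := h₁ []
  refine ⟨d, ?_, ?_, fun t ht => ?_, ?_⟩
  · simp [HaltsIn, DagApsp.run, h₁]
  · simpa [DagApsp.run, h₁] using h₃
  · rcases ht.lt_or_eq with ht | rfl
    · exact (h₄ t ht).1
    · simpa [DagApsp.run, h₁] using h₂
  · rintro c ⟨i, hi, hc⟩
    exact (h₄ i hi).2 c hc

/-! ### Changed cells are accessed cells -/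

theorem step_iarr_eq (x : Config) (a i : ℕ) (h : Config.cell x ≠ some (.int a i)) :
    (step x).2.iarr a i = x.2.iarr a i := by
  obtain ⟨l, s⟩ := x
  rcases l with _ | ⟨c, k⟩
  · rfl
  cases c with
  | skip => rfl
  | seq c d => rfl
  | ite b c d => simp only [step]; split_ifs <;> rfl
  | loop b c => simp only [step]; split_ifs <;> rfl
  | instr j =>
    cases j with
    | store a' x y =>
      simp only [Config.cell, Instr.cell, ne_eq, Option.some.injEq, Cell.int.injEq, not_and] at h
      simp only [step, Instr.exec, Function.update_apply]
      split_ifs with h1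
      · subst h1
        exact Function.update_of_ne (fun h2 => h rfl h2.symm) _ _
      · rfl
    | _ => rfl

/-- A cell whose content has changed has been accessed. -/
theorem exists_cell_of_iarr_ne (P : Prog) (s : State) (T a i : ℕ)
    (h : (run P s T).2.iarr a i ≠ s.iarr a i) :
    ∃ t < T, Config.cell (run P s t) = some (.int a i) := by
  induction T with
  | zero => exact absurd rfl h
  | succ T ih =>
    by_cases hT : Config.cell (run P s T) = some (.int a i)
    · exact ⟨T, by omega, hT⟩
    · obtain ⟨t, ht, h'⟩ := ih (by
        rw [← step_iarr_eq _ a i hT]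
        simpa only [run, Function.iterate_succ_apply'] using h)
      exact ⟨t, by omega, h'⟩

/-! ### Paths -/

namespace WDigraph

variable {n : ℕ} {G : WDigraph n}

theorem isPath_nil_iff {u v : Fin n} : G.IsPath u v [] ↔ u = v := by
  constructor
  · intro h; cases h; rfl
  · rintro rfl; exact .nil _

theorem isPath_cons_iff {u v : Fin n} {e : Fin G.m} {p : List (Fin G.m)} :
    G.IsPath u v (e :: p) ↔ G.src e = u ∧ G.IsPath (G.tgt e) v p := by
  constructor
  · intro h; cases h with | cons e v p h => exact ⟨rfl, h⟩
  · rintro ⟨rfl, h⟩; exact .cons _ _ _ h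

theorem isPath_append_iff {u v : Fin n} {p q : List (Fin G.m)} :
    G.IsPath u v (p ++ q) ↔ ∃ w, G.IsPath u w p ∧ G.IsPath w v q := by
  induction p generalizing u with
  | nil => simp [isPath_nil_iff]
  | cons e p ih => simp [isPath_cons_iff, ih, and_assoc]

theorem isPath_concat_iff {u v : Fin n} {p : List (Fin G.m)} {e : Fin G.m} :
    G.IsPath u v (p ++ [e]) ↔ G.IsPath u (G.src e) p ∧ G.tgt e = v := by
  simp only [isPath_append_iff, isPath_cons_iff, isPath_nil_iff]
  constructor
  · rintro ⟨w, h, rfl, h'⟩; exact ⟨h, h'⟩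
  · rintro ⟨h, h'⟩; exact ⟨_, h, rfl, h'⟩

theorem isPath_singleton (e : Fin G.m) : G.IsPath (G.src e) (G.tgt e) [e] :=
  .cons _ _ _ (.nil _)

theorem pathLen_append (p q : List (Fin G.m)) :
    G.pathLen (p ++ q) = G.pathLen p + G.pathLen q := by
  simp [pathLen]

theorem pathLen_singleton (e : Fin G.m) : G.pathLen [e] = G.len e := by
  simp [pathLen]

theorem Acyclic.src_ne_tgt (hG : G.Acyclic) (e : Fin G.m) : G.src e ≠ G.tgt e := by
  intro h
  have := hG (G.src e) [e] (isPath_cons_iff.2 ⟨rfl, isPath_nil_iff.2 h.symm⟩)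
  simp at this

/-- An edge is determined by its endpoints. The bound keeps edge numbers within the `n * n`
available cells and makes linear work on the edge list `O(n²)`. -/
theorem m_le (G : WDigraph n) : G.m ≤ n * n := by
  have := Fintype.card_le_of_injective (fun e : Fin G.m => (G.src e, G.tgt e)) (fun e f h => by
    simp only [Prod.mk.injEq] at h; exact G.simple e f h.1 h.2)
  simpa using this

/-- A set of vertices that is not everything can be extended by a vertex all of whose predecessors
belong to it. -/
theorem Acyclic.exists_source (hG : G.Acyclic) (S : Set (Fin n)) (hS : ∃ v, v ∉ S) :
    ∃ v, v ∉ S ∧ ∀ e, G.tgt e = v → G.src e ∈ S := by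
  -- Being joined by a nonempty path is a strict order on a finite set, hence well-founded; a
  -- minimal vertex outside `S` is the required one.
  let r : Fin n → Fin n → Prop := fun a b => ∃ p, p ≠ [] ∧ G.IsPath a b p
  have htrans : IsTrans (Fin n) r := ⟨by
    rintro a b c ⟨p, hp, h⟩ ⟨q, -, h'⟩
    exact ⟨p ++ q, by simp [hp], isPath_append_iff.2 ⟨b, h, h'⟩⟩⟩
  have hirr : Std.Irrefl r := ⟨by
    rintro a ⟨p, hp, h⟩
    exact hp (hG a p h)⟩
  have hwf : WellFounded r := Finite.wellFounded_of_trans_of_irrefl r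
  obtain ⟨v, hv, hmin⟩ := hwf.has_min {v | v ∉ S} hS
  refine ⟨v, hv, fun e he => ?_⟩
  by_contra h
  exact hmin _ h ⟨[e], by simp, he ▸ isPath_singleton e⟩

/-- Along a path the positions in a topological order do not decrease. -/
theorem exists_le_of_isPath {q : ℕ → Fin n} {i : ℕ}
    (htopo : ∀ k < i, ∀ e, G.tgt e = q k → ∃ j < k, G.src e = q j)
    {u v : Fin n} {p : List (Fin G.m)} (h : G.IsPath u v p) {k : ℕ} (hk : k < i) (hv : v = q k) :
    ∃ j ≤ k, u = q j := by
  induction h with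
  | nil u => exact ⟨k, le_rfl, hv⟩
  | cons e v p h ih =>
    obtain ⟨j, hj, hj'⟩ := ih hv
    obtain ⟨l, hl, hl'⟩ := htopo j (by omega) e hj'
    exact ⟨l, by omega, hl'⟩

/-! ### Entries of the output matrices -/

variable (G)

/-- The edges that are contained in at least one shortest path. -/
def shortestEdges : Set (Fin G.m) := {e | ∃ u v p, G.IsShortestPath u v p ∧ e ∈ p}

/-- `p` is a path from `u` to `v` whose last edge, if any, starts in `W`. -/
def IsPathVia (W : Set (Fin n)) (u v : Fin n) (p : List (Fin G.m)) : Prop :=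
  G.IsPath u v p ∧ ∀ e, p.getLast? = some e → G.src e ∈ W

/-- `d` and `c` are the length and the code of the last but one vertex of a shortest path among the
paths that satisfy `P`. -/
def IsEntry (P : List (Fin G.m) → Prop) (d : ℝ) (c : ℕ) : Prop :=
  ((∃ p, P p) → ∃ p, (P p ∧ ∀ q, P q → G.pathLen p ≤ G.pathLen q) ∧ d = G.pathLen p ∧
    c = p.getLast?.elim 0 (fun e => (G.src e : ℕ) + 1)) ∧
  ((¬ ∃ p, P p) → c = 0)

variable {G} {W : Set (Fin n)} {u v w : Fin n} {d dw : ℝ} {c cw : ℕ} {e : Fin G.m}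

theorem isPathVia_nil_iff : G.IsPathVia W u v [] ↔ u = v := by
  simp [IsPathVia, isPath_nil_iff]

theorem isPathVia_concat_iff {p : List (Fin G.m)} {e : Fin G.m} :
    G.IsPathVia W u v (p ++ [e]) ↔ G.IsPath u (G.src e) p ∧ G.tgt e = v ∧ G.src e ∈ W := by
  simp [IsPathVia, isPath_concat_iff, and_assoc]

theorem IsPathVia.mono {W' : Set (Fin n)} (hW : W ⊆ W') {p : List (Fin G.m)}
    (h : G.IsPathVia W u v p) : G.IsPathVia W' u v p :=
  ⟨h.1, fun e he => hW (h.2 e he)⟩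

/-- Only the empty path has no last edge to constrain. So an untouched column of zeros is correct:
distance `0` on the diagonal, code `0` for "no path" elsewhere. -/
theorem isEntry_empty (hd : d = 0) : G.IsEntry (G.IsPathVia ∅ u v) d 0 := by
  refine ⟨?_, fun _ => rfl⟩
  have key : ∀ p, G.IsPathVia ∅ u v p → p = [] := by
    intro p hp
    rcases List.eq_nil_or_concat p with rfl | ⟨q, e, rfl⟩
    · rfl
    · exact absurd (isPathVia_concat_iff.1 (by simpa using hp)).2.2 (by simp)
  rintro ⟨p, hp⟩
  obtain rfl := key p hp
  refine ⟨[], ⟨hp, fun q hq => by rw [key q hq]⟩, by simp [hd, pathLen], by simp⟩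

/-- Code `0` stands both for the empty path and for no path. Off the diagonal the first reading is
impossible, so `0` plays the role of an infinite distance. -/
theorem IsEntry.eq_nil_of_eq_zero (h : G.IsEntry (G.IsPathVia W u v) d 0) (huv : u ≠ v) :
    ¬ ∃ p, G.IsPathVia W u v p := by
  intro hp
  obtain ⟨p, ⟨hp, -⟩, -, hc⟩ := h.1 hp
  rcases List.eq_nil_or_concat p with rfl | ⟨q, e, rfl⟩
  · exact huv (isPathVia_nil_iff.1 hp)
  · simp at hc

/-- The new paths that a vertex `w` with an edge to `v` gives rise to. -/
theorem isPathVia_insert_iff {p : List (Fin G.m)} (hw : G.src e = w) (hv : G.tgt e = v) :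
    G.IsPathVia (insert w W) u v p ↔
      G.IsPathVia W u v p ∨ ∃ q, p = q ++ [e] ∧ G.IsPath u w q := by
  constructor
  · intro hp
    rcases List.eq_nil_or_concat' p with rfl | ⟨q, f, rfl⟩
    · exact .inl (isPathVia_nil_iff.2 (isPathVia_nil_iff.1 hp))
    · obtain ⟨h₁, h₂, h₃⟩ := isPathVia_concat_iff.1 hp
      rcases h₃ with h₃ | h₃
      · obtain rfl : f = e := G.simple _ _ (h₃.trans hw.symm) (h₂.trans hv.symm)
        exact .inr ⟨q, rfl, h₃ ▸ h₁⟩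
      · exact .inl (isPathVia_concat_iff.2 ⟨h₁, h₂, h₃⟩)
  · rintro (h | ⟨q, rfl, h⟩)
    · exact h.mono (Set.subset_insert _ _)
    · exact isPathVia_concat_iff.2 ⟨hw ▸ h, hv, by simp [hw]⟩

theorem isPathVia_insert_of_no_edge (h : ∀ e, G.src e = w → G.tgt e ≠ v) :
    G.IsPathVia (insert w W) u v = G.IsPathVia W u v := by
  funext p
  refine propext ⟨fun hp => ⟨hp.1, fun e he => ?_⟩, fun hp => hp.mono (Set.subset_insert _ _)⟩
  rcases hp.2 e he with h' | h'
  · obtain ⟨q, rfl⟩ := List.getLast?_eq_some_iff.1 he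
    exact absurd (isPath_concat_iff.1 hp.1).2 (h e h')
  · exact h'

theorem isPathVia_eq_isPath (h : ∀ e, G.tgt e = v → G.src e ∈ W) :
    G.IsPathVia W u v = G.IsPath u v := by
  funext p
  refine propext ⟨fun hp => hp.1, fun hp => ⟨hp, fun e he => ?_⟩⟩
  obtain ⟨q, rfl⟩ := List.getLast?_eq_some_iff.1 he
  exact h e (isPath_concat_iff.1 hp).2

/-- If the paths in the larger class `P'` are not shorter than those in `P`, then an entry for `P` is
one for `P'`. -/
theorem IsEntry.of_dominated {P P' : List (Fin G.m) → Prop} (h : G.IsEntry P d c)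
    (hP : ∀ p, P p → P' p) (hdom : ∀ p, P' p → ∃ q, P q ∧ G.pathLen q ≤ G.pathLen p) :
    G.IsEntry P' d c := by
  constructor
  · rintro ⟨p, hp⟩
    obtain ⟨q, hq, -⟩ := hdom p hp
    obtain ⟨r, ⟨hr, hmin⟩, h'⟩ := h.1 ⟨q, hq⟩
    refine ⟨r, ⟨hP r hr, fun x hx => ?_⟩, h'⟩
    obtain ⟨y, hy, hyx⟩ := hdom x hx
    exact (hmin y hy).trans hyx
  · intro hP'
    exact h.2 fun ⟨p, hp⟩ => hP' ⟨p, hP p hp⟩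

/-- In a path `r ++ [e]` the edge `e` is replaced by the known path from `w` to `v`. Because `cw ≠
0`, that path is nonempty, so its last edge, which starts in `W`, is also the last edge of the
composite. Nothing here depends on `u`: a single test discards the edge for all rows. -/
theorem IsEntry.insert_of_not_lt (hw : G.src e = w) (hv : G.tgt e = v)
    (hwv : G.IsEntry (G.IsPathVia W w v) dw cw) (hc : cw ≠ 0) (hle : ¬ G.len e < dw)
    (h : G.IsEntry (G.IsPathVia W u v) d c) : G.IsEntry (G.IsPathVia (insert w W) u v) d c := by
  have hex : ∃ p, G.IsPathVia W w v p := by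
    by_contra h'
    exact hc (hwv.2 h')
  obtain ⟨p, ⟨hp, -⟩, hd, hcp⟩ := hwv.1 hex
  refine h.of_dominated (fun q hq => hq.mono (Set.subset_insert _ _)) fun q hq => ?_
  rcases (isPathVia_insert_iff hw hv).1 hq with hq | ⟨r, rfl, hr⟩
  · exact ⟨q, hq, le_rfl⟩
  · rcases List.eq_nil_or_concat' p with rfl | ⟨p, f, rfl⟩
    · simp at hcp; exact absurd hcp hc
    · obtain ⟨h₁, h₂, h₃⟩ := isPathVia_concat_iff.1 hp
      refine ⟨(r ++ p) ++ [f], isPathVia_concat_iff.2 ⟨isPath_append_iff.2 ⟨w, hr, h₁⟩, h₂, h₃⟩, ?_⟩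
      rw [List.append_assoc, pathLen_append, pathLen_append r [e], pathLen_singleton, ← hd]
      linarith

theorem IsEntry.insert_of_not_reachable (hw : G.src e = w) (hv : G.tgt e = v)
    (huw : ¬ ∃ p, G.IsPath u w p)
    (h : G.IsEntry (G.IsPathVia W u v) d c) : G.IsEntry (G.IsPathVia (insert w W) u v) d c := by
  refine h.of_dominated (fun q hq => hq.mono (Set.subset_insert _ _)) fun q hq => ?_
  rcases (isPathVia_insert_iff hw hv).1 hq with hq | ⟨r, -, hr⟩
  · exact ⟨q, hq, le_rfl⟩
  · exact absurd ⟨r, hr⟩ huw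

theorem IsEntry.insert_of_le (hw : G.src e = w) (hv : G.tgt e = v)
    (huw : G.IsEntry (G.IsPath u w) dw cw) (hc : c ≠ 0) (hle : ¬ dw + G.len e < d)
    (h : G.IsEntry (G.IsPathVia W u v) d c) : G.IsEntry (G.IsPathVia (insert w W) u v) d c := by
  refine h.of_dominated (fun q hq => hq.mono (Set.subset_insert _ _)) fun q hq => ?_
  rcases (isPathVia_insert_iff hw hv).1 hq with hq | ⟨r, rfl, hr⟩
  · exact ⟨q, hq, le_rfl⟩
  · have hex : ∃ p, G.IsPathVia W u v p := by
      by_contra h'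
      exact hc (h.2 h')
    obtain ⟨p, ⟨hp, -⟩, hd, -⟩ := h.1 hex
    obtain ⟨p', ⟨-, hmin⟩, hd', -⟩ := huw.1 ⟨r, hr⟩
    refine ⟨p, hp, ?_⟩
    have := hmin r hr
    rw [pathLen_append, pathLen_singleton, ← hd]
    linarith

/-- The case `c = 0` is a comparison with infinity. It needs `u ≠ v`, since on the diagonal `0`
encodes the empty path. -/
theorem IsEntry.insert_of_lt (hw : G.src e = w) (hv : G.tgt e = v) (huv : u ≠ v)
    (hr : ∃ p, G.IsPath u w p) (huw : G.IsEntry (G.IsPath u w) dw cw)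
    (h : G.IsEntry (G.IsPathVia W u v) d c) (hlt : c = 0 ∨ dw + G.len e < d) :
    G.IsEntry (G.IsPathVia (insert w W) u v) (dw + G.len e) ((w : ℕ) + 1) := by
  obtain ⟨p, ⟨hp, hmin⟩, hd, -⟩ := huw.1 hr
  have hpe : G.IsPathVia (insert w W) u v (p ++ [e]) :=
    (isPathVia_insert_iff hw hv).2 (.inr ⟨p, rfl, hp⟩)
  refine ⟨fun _ => ⟨p ++ [e], ⟨hpe, fun q hq => ?_⟩, ?_, ?_⟩, fun h' => absurd ⟨_, hpe⟩ h'⟩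
  · rw [pathLen_append, pathLen_singleton]
    rcases (isPathVia_insert_iff hw hv).1 hq with hq | ⟨r, rfl, hr⟩
    · rcases hlt with rfl | hlt
      · exact absurd ⟨q, hq⟩ (h.eq_nil_of_eq_zero huv)
      · obtain ⟨p', ⟨-, hmin'⟩, hd', -⟩ := h.1 ⟨q, hq⟩
        have := hmin' q hq
        linarith
    · rw [pathLen_append, pathLen_singleton]
      have := hmin r hr
      linarith
  · rw [pathLen_append, pathLen_singleton, hd]
  · simp [hw]

/-- An edge that improves the distance over the paths via the later vertices is a shortest path. -/
theorem IsEntry.mem_shortestEdges (hG : G.Acyclic) (hw : G.src e = w) (hv : G.tgt e = v)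
    (hW : ∀ f, G.tgt f = v → G.src f ≠ w → (∃ p, G.IsPath w (G.src f) p) → G.src f ∈ W)
    (h : G.IsEntry (G.IsPathVia W w v) d c) (hlt : c = 0 ∨ G.len e < d) :
    e ∈ G.shortestEdges := by
  have hwv : w ≠ v := by
    rw [← hw, ← hv]; exact hG.src_ne_tgt e
  refine ⟨w, v, [e], ⟨by rw [← hw, ← hv]; exact isPath_singleton e, fun q hq => ?_⟩, by simp⟩
  rcases List.eq_nil_or_concat' q with rfl | ⟨q, f, rfl⟩
  · exact absurd (isPath_nil_iff.1 hq) hwv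
  obtain ⟨h₁, h₂⟩ := isPath_concat_iff.1 hq
  -- If the last edge `f` of the competitor starts at `w`, then `f = e` and the rest is a closed
  -- path, hence empty. Otherwise `hW` makes the competitor one of the paths that `d` has taken into
  -- account.
  by_cases hf : G.src f = w
  · obtain rfl : f = e := G.simple _ _ (hf.trans hw.symm) (h₂.trans hv.symm)
    obtain rfl := hG _ _ (hf ▸ h₁)
    simp
  · have hvia : G.IsPathVia W w v (q ++ [f]) :=
      isPathVia_concat_iff.2 ⟨h₁, h₂, hW f h₂ hf ⟨q, h₁⟩⟩
    rcases hlt with rfl | hlt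
    · exact absurd ⟨_, hvia⟩ (h.eq_nil_of_eq_zero hwv)
    · obtain ⟨p', ⟨-, hmin'⟩, hd', -⟩ := h.1 ⟨_, hvia⟩
      have := hmin' _ hvia
      rw [pathLen_singleton]
      linarith

/-- A weakly connected graph has at least `n - 1` edges in shortest paths. -/
theorem WeaklyConnected.le_mStar (hc : G.WeaklyConnected) (hn : 1 ≤ n)
    (hsp : ∀ u v, G.Reachable u v → ∃ p, G.IsShortestPath u v p) : n ≤ G.mStar + 1 := by
  have : Nonempty (Fin n) := ⟨⟨0, hn⟩⟩
  let H : SimpleGraph (Fin n) :=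
    SimpleGraph.fromRel fun a b => ∃ e ∈ G.shortestEdges, G.src e = a ∧ G.tgt e = b
  have hpath : ∀ u v p, G.IsPath u v p → (∀ e ∈ p, e ∈ G.shortestEdges) → H.Reachable u v := by
    intro u v p hp
    induction hp with
    | nil u => intro _; exact .refl _
    | cons e v p hp ih =>
      intro h
      refine SimpleGraph.Reachable.trans ?_ (ih fun f hf => h f (by simp [hf]))
      by_cases hne : G.src e = G.tgt e
      · rw [hne]
      · exact SimpleGraph.Adj.reachable ((SimpleGraph.fromRel_adj _ _ _).2
          ⟨hne, .inl ⟨e, h e (by simp), rfl, rfl⟩⟩)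
  have hconn : H.Connected := by
    refine ⟨fun u v => ?_⟩
    induction hc u v with
    | rel a b h =>
      obtain ⟨e, rfl, rfl⟩ := h
      -- The edge `e` itself may lie on no shortest path, but its endpoints are joined by one, and
      -- all edges of that path belong to `H`.
      obtain ⟨p, hp⟩ := hsp _ _ ⟨[e], isPath_singleton e⟩
      exact hpath _ _ p hp.1 fun f hf => ⟨_, _, p, hp, hf⟩
    | refl a => exact .refl _
    | symm a b _ ih => exact ih.symm
    | trans a b c _ _ ih₁ ih₂ => exact ih₁.trans ih₂
  have h₁ := hconn.card_vert_le_card_edgeSet_add_one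
  have h₂ : H.edgeSet.ncard ≤ G.mStar := by
    have hsub : H.edgeSet ⊆ (fun e => s(G.src e, G.tgt e)) '' G.shortestEdges := by
      intro x
      induction x using Sym2.ind with
      | _ a b =>
        intro hab
        obtain ⟨-, ⟨e, he, rfl, rfl⟩ | ⟨e, he, rfl, rfl⟩⟩ := (SimpleGraph.fromRel_adj _ _ _).1
          (SimpleGraph.mem_edgeSet H |>.1 hab)
        · exact ⟨e, he, rfl⟩
        · exact ⟨e, he, Sym2.eq_swap⟩
    exact (Set.ncard_le_ncard hsub (Set.toFinite _)).trans (Set.ncard_image_le (Set.toFinite _))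
  rw [Nat.card_coe_set_eq] at h₁
  simp only [Nat.card_eq_fintype_card, Fintype.card_fin] at h₁
  omega

end WDigraph

/-! ### The program

Integer array `3` holds the adjacency matrix: `1` for a missing edge and `e + 2` for the edge `e`.
Integer array `4` holds, for every vertex, the number of its in-edges from vertices that have not been
placed yet, plus one if the vertex itself has been placed.  Integer array `6` holds the topological
order in which the vertices are placed. -/

infixr:60 ";;" => Prog.seq

/-- Fill the adjacency matrix with the marker for a missing edge. -/
def fillLoop : Prog :=
  .loop (.lt 5 4) (code [.store 3 5 3, .add 5 5 3])

/-- Enter the edges into the adjacency matrix and count the in-edges. -/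
def edgeLoop : Prog :=
  .loop (.lt 5 1) (code [.load 6 0 5, .load 7 1 5, .mul 8 6 0, .add 8 8 7, .add 9 5 3, .add 9 9 3,
    .store 3 8 9, .load 9 4 7, .add 9 9 3, .store 4 7 9, .add 5 5 3])

/-- Register `2` is never written and serves as the constant `0`; register `3` keeps the constant
`1` and register `4` the bound `n * n`. -/
def initCode : Prog :=
  code [.const 3 1, .mul 4 0 0] ;; fillLoop ;; code [.const 5 0] ;; edgeLoop ;; code [.const 5 0]

/-- Let register `6` be a vertex that has not been placed and all of whose predecessors have. -/
def findLoop : Prog :=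
  .loop (.lt 7 0) (code [.load 8 4 7] ;; .ite (.eq 8 2) (code [.move 6 7]) .skip ;; code [.add 7 7 3])

/-- Let registers `11` and `13` be the indices of the entries at (`10`, `8`) and (`10`, `6`), and let
register `14` be positive if vertex `8` can be reached from vertex `10`. -/
def reachCode : Prog :=
  code [.mul 13 10 0, .add 11 13 8, .add 13 13 6, .load 14 2 11] ;;
    .ite (.eq 10 8) (code [.const 14 1]) .skip

/-- Let real register `1` be the length of the new path and let register `12` be `1` if it is shorter
than the best path known so far. -/
def compareCode : Prog :=
  code [.rload 1 1 11, .radd 1 1 0, .load 15 2 13, .rload 2 1 13, .const 12 0] ;;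
    .ite (.eq 15 2) (code [.const 12 1]) .skip ;; .ite (.rlt 1 2) (code [.const 12 1]) .skip

/-- Use the edge from the vertex in register `8` to the vertex in register `6`, whose length is in
real register `0`, to improve the distances to the latter. -/
def relaxLoop : Prog :=
  .loop (.lt 10 0)
    (reachCode ;;
      .ite (.lt 2 14)
        (compareCode ;; .ite (.eq 12 3) (code [.rstore 1 13 1, .store 2 13 9]) .skip)
        .skip ;;
      code [.add 10 10 3])

/-- For the edge number `10` from vertex `8` to vertex `6`, let register `12` be `1` if the edge is
shorter than the best path known so far, whose entry has the index `9`. -/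
def edgeTestCode : Prog :=
  code [.rload 0 0 10, .load 11 2 9, .rload 1 1 9, .const 12 0] ;;
    .ite (.eq 11 2) (code [.const 12 1]) .skip ;; .ite (.rlt 0 1) (code [.const 12 1]) .skip

/-- Treat the edge, if any, from the vertex in register `8` to the vertex in register `6`. -/
def edgeCode : Prog :=
  code [.mul 9 8 0, .add 9 9 6, .load 10 3 9] ;;
  .ite (.lt 3 10)
    (code [.sub 10 10 3, .sub 10 10 3] ;; edgeTestCode ;;
      .ite (.eq 12 3) (code [.add 9 8 3, .const 10 0] ;; relaxLoop) .skip)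
    .skip

/-- Treat the edges into the vertex in register `6`, the last source in topological order first. -/
def inEdgeLoop : Prog :=
  .loop (.lt 2 7) (code [.sub 7 7 3, .load 8 6 7] ;; edgeCode)

/-- Update the in-edge counters after the vertex in register `6` has been placed. -/
def countLoop : Prog :=
  .loop (.lt 7 0)
    (code [.add 9 8 7, .load 10 3 9] ;;
      .ite (.lt 3 10) (code [.load 11 4 7, .sub 11 11 3, .store 4 7 11]) .skip ;;
      code [.add 7 7 3])

/-- The new vertex has counter `0`. Overwriting it with `1` prevents the vertex from being found
again. -/
def mainLoop : Prog :=
  .loop (.lt 5 0)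
    (code [.const 7 0] ;; findLoop ;; code [.store 6 5 6, .store 4 6 3, .move 7 5] ;;
      inEdgeLoop ;; code [.const 7 0, .mul 8 6 0] ;; countLoop ;; code [.add 5 5 3])

/-- All-pairs shortest paths in a directed acyclic graph. -/
def apsp : Prog := initCode ;; mainLoop

/-- The first `N` cells of the first eight integer and real arrays. -/
def cells (N : ℕ) : Set Cell :=
  {c | match c with | .int a i => a < 8 ∧ i < N | .real a i => a < 8 ∧ i < N}

@[simp] theorem int_mem_cells {N a i : ℕ} : Cell.int a i ∈ cells N ↔ a < 8 ∧ i < N := Iff.rfl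

@[simp] theorem real_mem_cells {N a i : ℕ} : Cell.real a i ∈ cells N ↔ a < 8 ∧ i < N := Iff.rfl

section

variable {n : ℕ}

theorem idx_lt (u v : Fin n) : (u : ℕ) * n + v < n * n := by
  have := Nat.mul_le_mul_right n (Nat.succ_le_of_lt u.2)
  have := v.2
  rw [Nat.succ_mul] at *
  omega

theorem row_le (u : Fin n) : (u : ℕ) * n ≤ n * n := Nat.mul_le_mul_right n u.2.le

theorem idx_inj {u v u' v' : Fin n} : (u : ℕ) * n + v = u' * n + v' ↔ u = u' ∧ v = v' := by
  constructor
  · intro h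
    have hn : 0 < n := u.pos
    have h₁ := congrArg (· / n) h
    have h₂ := congrArg (· % n) h
    simp only [Nat.mul_add_mod_self_right, Nat.mod_eq_of_lt v.2, Nat.mod_eq_of_lt v'.2] at h₂
    simp only [Nat.add_div_of_dvd_right (Dvd.intro_left _ rfl), Nat.mul_div_cancel _ hn,
      Nat.div_eq_of_lt v.2, Nat.div_eq_of_lt v'.2] at h₁
    exact ⟨Fin.ext (by simpa using h₁), Fin.ext h₂⟩
  · rintro ⟨rfl, rfl⟩; rfl

end

/-! ### Verification -/

variable {n : ℕ} (G : WDigraph n)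

/-- The adjacency matrix and the constants that the main loop uses. -/
structure Static (s : State) : Prop where
  r0 : s.ireg 0 = n
  r2 : s.ireg 2 = 0
  r3 : s.ireg 3 = 1
  len : ∀ e : Fin G.m, s.rarr 0 e = G.len e
  adj_edge : ∀ e : Fin G.m, s.iarr 3 (G.src e * n + G.tgt e) = e + 2
  adj_none : ∀ u v, (∀ e, G.src e = u → G.tgt e ≠ v) → s.iarr 3 (u * n + v) = 1

variable {G}

/-- The bound `n * n + 3` on integers leaves room for loop counters up to `n * n` and edge codes up
to `n * n + 1`. Here and below the factors in the time bounds are generous estimates for one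
iteration. -/
theorem fillLoop_wp {s₀ : State} {t₀ : ℕ} (h1 : s₀.ireg 3 = 1) (h2 : s₀.ireg 4 = n * n)
    (h3 : s₀.ireg 5 = 0) :
    Wp (n * n + 3) (cells (n * n)) fillLoop (fun s t => (∀ x ≤ 4, s.ireg x = s₀.ireg x) ∧
      (∀ a, a ≠ 3 → s.iarr a = s₀.iarr a) ∧ s.rarr = s₀.rarr ∧ (∀ i < n * n, s.iarr 3 i = 1) ∧
      t ≤ t₀ + 10 * (n * n) + 1) s₀ t₀ := by
  refine Wp.loop (n * n) (fun k s t => s.ireg 5 = k ∧ (∀ x ≤ 4, s.ireg x = s₀.ireg x) ∧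
      (∀ a, a ≠ 3 → s.iarr a = s₀.iarr a) ∧ s.rarr = s₀.rarr ∧ (∀ i < k, s.iarr 3 i = 1) ∧
      t ≤ t₀ + 10 * k) (by simp [h3]) ?_ ?_
  · rintro k hk s t ⟨h5, hr, ha, hra, hf, ht⟩
    refine ⟨by simpa [Test.holds, h5, hr, h2] using hk, Wp.of_vc ?_⟩
    simp [vc, code, Instr.Safe, Instr.exec, h5, hr, h1, hk, hra]
    refine ⟨by omega, fun x hx => ?_, fun a hx => ?_, fun i hi => ?_, by omega⟩
    · rw [Function.update_of_ne (by omega), hr x hx]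
    · rw [Function.update_of_ne hx, ha a hx]
    · rw [Function.update_apply]; split_ifs
      · rfl
      · exact hf i (by omega)
  · rintro s t ⟨h5, hr, ha, hra, hf, ht⟩
    exact ⟨by simp [Test.holds, h5, hr, h2], hr, ha, hra, hf, by omega⟩

open Classical in
theorem edgeLoop_wp {s₀ : State} {t₀ : ℕ} (h0 : s₀.ireg 0 = n) (h1 : s₀.ireg 1 = G.m)
    (h3 : s₀.ireg 3 = 1) (h5 : s₀.ireg 5 = 0) (hsrc : ∀ e : Fin G.m, s₀.iarr 0 e = G.src e)
    (htgt : ∀ e : Fin G.m, s₀.iarr 1 e = G.tgt e) (hadj : ∀ i < n * n, s₀.iarr 3 i = 1)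
    (hcnt : ∀ i, s₀.iarr 4 i = 0) :
    Wp (n * n + 3) (cells (n * n)) edgeLoop (fun s t => (∀ x ≤ 4, s.ireg x = s₀.ireg x) ∧
      (∀ a, a ≠ 3 → a ≠ 4 → s.iarr a = s₀.iarr a) ∧ s.rarr = s₀.rarr ∧
      (∀ e : Fin G.m, s.iarr 3 (G.src e * n + G.tgt e) = e + 2) ∧
      (∀ u v, (∀ e, G.src e = u → G.tgt e ≠ v) → s.iarr 3 (u * n + v) = 1) ∧
      (∀ v : Fin n, s.iarr 4 v = (Finset.univ.filter fun e => G.tgt e = v).card) ∧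
      t ≤ t₀ + 40 * G.m + 1) s₀ t₀ := by
  refine Wp.loop G.m (fun k s t => s.ireg 5 = k ∧ (∀ x ≤ 4, s.ireg x = s₀.ireg x) ∧
      (∀ a, a ≠ 3 → a ≠ 4 → s.iarr a = s₀.iarr a) ∧ s.rarr = s₀.rarr ∧
      (∀ e : Fin G.m, (e : ℕ) < k → s.iarr 3 (G.src e * n + G.tgt e) = e + 2) ∧
      (∀ u v, (∀ e : Fin G.m, (e : ℕ) < k → G.src e = u → G.tgt e ≠ v) →
        s.iarr 3 (u * n + v) = 1) ∧
      (∀ v : Fin n, s.iarr 4 v = (Finset.univ.filter fun e : Fin G.m =>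
        (e : ℕ) < k ∧ G.tgt e = v).card) ∧
      t ≤ t₀ + 40 * k) ?_ ?_ ?_
  · exact ⟨h5, by simp, by simp, rfl, by simp, fun u v _ => hadj _ (idx_lt u v), by simp [hcnt],
      by simp⟩
  · rintro k hk s t ⟨h5, hr, ha, hra, he, hno, hc, ht⟩
    refine ⟨by simpa [Test.holds, h5, hr, h1] using hk, Wp.of_vc ?_⟩
    have hs := hsrc ⟨k, hk⟩
    have ht' := htgt ⟨k, hk⟩
    have hcv := hc (G.tgt ⟨k, hk⟩)
    have hle : (Finset.univ.filter fun e : Fin G.m => (e : ℕ) < k ∧ G.tgt e = G.tgt ⟨k, hk⟩).card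
        ≤ G.m := (Finset.card_le_univ _).trans (by simp)
    have hm := G.m_le
    set u := G.src ⟨k, hk⟩ with hu
    set v := G.tgt ⟨k, hk⟩ with hv
    simp only at hs ht'
    have hi := idx_lt u v
    have h2 := row_le u
    have h4 : n ≤ n * n := Nat.le_mul_self n
    have h6 := v.2
    simp [vc, code, Instr.Safe, Instr.exec, h5, hr, h0, h3, ha, hs, ht', hra, hcv]
    refine ⟨by omega, by omega, by omega, by omega, by omega, by omega, by omega, by omega, by omega,
      by omega, fun x hx => ?_,
      fun a hx hx' => ?_, fun e hek => ?_, fun u' v' huv => ?_, fun v' => ?_, by omega⟩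
    · simp only [Function.update_apply]
      simp [show x ≠ 5 by omega, show x ≠ 6 by omega, show x ≠ 7 by omega, show x ≠ 8 by omega,
        show x ≠ 9 by omega, hr x hx]
    · simp [hx, hx', ha]
    · rw [Function.update_apply]
      split_ifs with h
      -- Without parallel edges no matrix cell is written for two different edges.
      · obtain rfl : e = ⟨k, hk⟩ := G.simple _ _ (idx_inj.1 h).1 (idx_inj.1 h).2
        rfl
      · refine he e ?_
        rcases Nat.le_iff_lt_or_eq.1 hek with h' | h'
        · exact h'
        · exact absurd (by simp [hu, hv, ← h']) h
    · rw [Function.update_of_ne, hno u' v' fun e he => huv e (by omega)]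
      intro h
      obtain ⟨rfl, rfl⟩ := idx_inj.1 h
      exact huv ⟨k, hk⟩ (by simp) rfl rfl
    · rw [Function.update_apply]
      split_ifs with h
      · obtain rfl := Fin.ext h
        rw [← Finset.card_insert_of_notMem (a := (⟨k, hk⟩ : Fin G.m)) (by simp)]
        congr 1
        ext e
        simp only [Finset.mem_insert, Finset.mem_filter, Finset.mem_univ, true_and, Fin.ext_iff]
        constructor
        · rintro (h | h)
          · exact ⟨by omega, by rw [hv]; exact congrArg (fun e => (G.tgt e : ℕ)) (Fin.ext h)⟩
          · exact ⟨by omega, h.2⟩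
        · rintro ⟨h, h'⟩
          rcases Nat.le_iff_lt_or_eq.1 h with h | h
          · exact .inr ⟨h, h'⟩
          · exact .inl h
      · rw [hc v']
        congr 1
        ext e
        simp only [Finset.mem_filter, Finset.mem_univ, true_and]
        refine ⟨fun h' => ⟨by omega, h'.2⟩, fun h' => ⟨?_, h'.2⟩⟩
        rcases Nat.le_iff_lt_or_eq.1 h'.1 with h'' | h''
        · exact h''
        · obtain rfl : e = ⟨k, hk⟩ := Fin.ext h''
          exact absurd (by rw [← h'.2]) h
  · rintro s t ⟨h5, hr, ha, hra, he, hno, hc, ht⟩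
    exact ⟨by simp [Test.holds, h5, hr, h1], hr, ha, hra, fun e => he e e.2,
      fun u v h => hno u v fun e _ => h e, by simpa using hc, by omega⟩

/-! ### What the program pieces leave unchanged -/

theorem Static.congr {s₀ s : State} (h : Static G s₀) (hr : ∀ x ≤ 3, s.ireg x = s₀.ireg x)
    (hi : s.iarr 3 = s₀.iarr 3) (hd : s.rarr 0 = s₀.rarr 0) : Static G s where
  r0 := by rw [hr 0 (by simp), h.r0]
  r2 := by rw [hr 2 (by simp), h.r2]
  r3 := by rw [hr 3 (by simp), h.r3]
  len e := by rw [hd, h.len]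
  adj_edge e := by rw [hi, h.adj_edge]
  adj_none u v huv := by rw [hi, h.adj_none u v huv]

/-- `s` differs from `s₀` only in the integer registers above `r`, in the real registers and in
the columns `v` of the output matrices. -/
structure ColFrame (r : ℕ) (v : Fin n) (s₀ s : State) : Prop where
  ireg : ∀ x ≤ r, s.ireg x = s₀.ireg x
  iarr : ∀ a, a ≠ 2 → s.iarr a = s₀.iarr a
  rarr : ∀ a, a ≠ 1 → s.rarr a = s₀.rarr a
  icol : ∀ u x : Fin n, x ≠ v → s.iarr 2 (u * n + x) = s₀.iarr 2 (u * n + x)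
  rcol : ∀ u x : Fin n, x ≠ v → s.rarr 1 (u * n + x) = s₀.rarr 1 (u * n + x)

namespace ColFrame

variable {r : ℕ} {v : Fin n} {s₀ s₁ s : State}

theorem refl (s : State) : ColFrame r v s s :=
  ⟨fun _ _ => rfl, fun _ _ => rfl, fun _ _ => rfl, fun _ _ _ => rfl, fun _ _ _ => rfl⟩

theorem of_eq (hr : ∀ x ≤ r, s.ireg x = s₀.ireg x) (hi : s.iarr = s₀.iarr)
    (hd : s.rarr = s₀.rarr) : ColFrame r v s₀ s :=
  ⟨hr, by simp [hi], by simp [hd], by simp [hi], by simp [hd]⟩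

theorem trans (h₁ : ColFrame r v s₀ s₁) (h₂ : ColFrame r v s₁ s) : ColFrame r v s₀ s where
  ireg x hx := (h₂.ireg x hx).trans (h₁.ireg x hx)
  iarr x hx := (h₂.iarr x hx).trans (h₁.iarr x hx)
  rarr x hx := (h₂.rarr x hx).trans (h₁.rarr x hx)
  icol u x hx := (h₂.icol u x hx).trans (h₁.icol u x hx)
  rcol u x hx := (h₂.rcol u x hx).trans (h₁.rcol u x hx)

theorem mono {r' : ℕ} (hr : r' ≤ r) (h : ColFrame r v s₀ s) : ColFrame r' v s₀ s :=
  { h with ireg := fun x hx => h.ireg x (hx.trans hr) }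

theorem static (h : ColFrame r v s₀ s) (hr : 3 ≤ r) (hs : Static G s₀) : Static G s :=
  hs.congr (fun x hx => h.ireg x (hx.trans hr)) (h.iarr 3 (by simp)) (h.rarr 0 (by simp))

end ColFrame

/-- The scan does not stop at a hit. Before the first hit register `6` holds an old value, so the
invariant speaks of it only under the assumption that a vertex with counter `0` has been passed. -/
theorem findLoop_wp {s₀ : State} {t₀ : ℕ} (h0 : Static G s₀) (h7 : s₀.ireg 7 = 0)
    (hex : ∃ v : Fin n, s₀.iarr 4 v = 0) :
    Wp (n * n + 3) (cells (n * n)) findLoop (fun s t => (∀ x ≤ 5, s.ireg x = s₀.ireg x) ∧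
      s.iarr = s₀.iarr ∧ s.rarr = s₀.rarr ∧ (∃ v : Fin n, s.ireg 6 = v ∧ s₀.iarr 4 v = 0) ∧
      t ≤ t₀ + 20 * n + 1) s₀ t₀ := by
  refine Wp.loop n (fun k s t => s.ireg 7 = k ∧ (∀ x ≤ 5, s.ireg x = s₀.ireg x) ∧
      s.iarr = s₀.iarr ∧ s.rarr = s₀.rarr ∧ ((∃ v : Fin n, (v : ℕ) < k ∧ s₀.iarr 4 v = 0) →
        ∃ v : Fin n, s.ireg 6 = v ∧ s₀.iarr 4 v = 0) ∧ t ≤ t₀ + 20 * k) (by simp [h7]) ?_ ?_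
  · rintro k hk s t ⟨h7, hr, ha, hra, hv, ht⟩
    refine ⟨by simpa [Test.holds, h7, hr, h0.r0] using hk, Wp.of_vc ?_⟩
    have h4 : n ≤ n * n := Nat.le_mul_self n
    simp [vc, code, Instr.Safe, Instr.exec, Test.holds, h7, hr, ha, hra, h0.r2, h0.r3]
    refine ⟨by omega, fun hz => ⟨by omega, fun x hx => ?_, fun v _ _ => ⟨⟨k, hk⟩, rfl, hz⟩,
      by omega⟩, fun hz => ⟨by omega, fun x hx => ?_, fun v hvk hv0 => ?_, by omega⟩⟩
    · simp [show x ≠ 8 by omega, show x ≠ 7 by omega,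
        show x ≠ 6 by omega, hr x hx]
    · simp [show x ≠ 8 by omega, show x ≠ 7 by omega, hr x hx]
    · refine hv ⟨v, lt_of_le_of_ne hvk fun h => hz (h ▸ hv0), hv0⟩
  · rintro s t ⟨h7, hr, ha, hra, hv, ht⟩
    obtain ⟨v, hv0⟩ := hex
    exact ⟨by simp [Test.holds, h7, hr, h0.r0], hr, ha, hra, hv ⟨v, v.2, hv0⟩, by omega⟩

/-- `s` differs from `s₀` only in the integer registers above `r` and in the real registers other
than `0`. -/
structure RegFrame (r : ℕ) (s₀ s : State) : Prop where
  ireg : ∀ x ≤ r, s.ireg x = s₀.ireg x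
  rreg : s.rreg 0 = s₀.rreg 0
  iarr : s.iarr = s₀.iarr
  rarr : s.rarr = s₀.rarr

theorem RegFrame.trans {r : ℕ} {s₀ s₁ s : State} (h₁ : RegFrame r s₀ s₁) (h₂ : RegFrame r s₁ s) :
    RegFrame r s₀ s where
  ireg x hx := (h₂.ireg x hx).trans (h₁.ireg x hx)
  rreg := h₂.rreg.trans h₁.rreg
  iarr := h₂.iarr.trans h₁.iarr
  rarr := h₂.rarr.trans h₁.rarr

theorem RegFrame.colFrame {r : ℕ} {v : Fin n} {s₀ s : State} (h : RegFrame r s₀ s) :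
    ColFrame r v s₀ s :=
  .of_eq h.ireg h.iarr h.rarr

/-- A nonzero code means reachable, but the code on the diagonal is `0`; hence the separate test for
`u = w`. -/
theorem reachCode_wp {s : State} {t : ℕ} {u v w : Fin n} (hs : Static G s)
    (h6 : s.ireg 6 = v) (h8 : s.ireg 8 = w) (h10 : s.ireg 10 = u) :
    Wp (n * n + 3) (cells (n * n)) reachCode (fun s' t' => RegFrame 10 s s' ∧
      s'.ireg 11 = u * n + w ∧ s'.ireg 13 = u * n + v ∧
      (0 < s'.ireg 14 ↔ u = w ∨ s.iarr 2 (u * n + w) ≠ 0) ∧ t' ≤ t + 30) s t := by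
  refine Wp.of_vc ?_
  have i1 := idx_lt u v
  have i2 := idx_lt u w
  have i3 := row_le u
  simp [reachCode, vc, code, Instr.Safe, Instr.exec, Test.holds, h6, h8, h10, hs.r0]
  refine ⟨by omega, by omega, by omega, by omega, fun huw => ⟨⟨fun x hx => ?_, rfl, rfl, rfl⟩,
    .inl (Fin.ext huw)⟩, fun huw => ⟨⟨fun x hx => ?_, rfl, rfl, rfl⟩, ?_⟩⟩
  · simp (disch := omega)
  · simp (disch := omega)
  · simp [Nat.pos_iff_ne_zero, Fin.ext_iff, huw]

theorem compareCode_wp {s : State} {t : ℕ} {u v w : Fin n} (hs : Static G s)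
    (h11 : s.ireg 11 = u * n + w) (h13 : s.ireg 13 = u * n + v) :
    Wp (n * n + 3) (cells (n * n)) compareCode (fun s' t' => RegFrame 10 s s' ∧
      s'.ireg 13 = u * n + v ∧ s'.rreg 1 = s.rarr 1 (u * n + w) + s.rreg 0 ∧
      (s'.ireg 12 = 1 ↔ s.iarr 2 (u * n + v) = 0 ∨
        s.rarr 1 (u * n + w) + s.rreg 0 < s.rarr 1 (u * n + v)) ∧ t' ≤ t + 30) s t := by
  refine Wp.of_vc ?_
  have i1 := idx_lt u v
  have i2 := idx_lt u w
  simp [compareCode, vc, code, Instr.Safe, Instr.exec, Test.holds, h11, h13, hs.r2]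
  have key : ∀ a b rr, (∀ x, x ≠ 1 → x ≠ 2 → rr x = s.rreg x) → RegFrame 10 s
      ⟨Function.update (Function.update s.ireg 15 a) 12 b, rr, s.iarr, s.rarr⟩ :=
    fun a b rr h => ⟨fun x hx => by simp (disch := omega), h 0 (by simp) (by simp), rfl, rfl⟩
  refine ⟨i2, i1, fun h => ⟨fun h' => ⟨key _ _ _ ?_, .inl h⟩, fun h' => ⟨key _ _ _ ?_, .inl h⟩⟩,
    fun h => ⟨fun h' => ⟨key _ _ _ ?_, .inr h'⟩, fun h' => ⟨key _ _ _ ?_, h, h'⟩⟩⟩ <;>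
    (intro x h₁ h₂; simp [h₁, h₂])

theorem edgeTestCode_wp {s : State} {t : ℕ} {v w : Fin n} {e : Fin G.m} (hs : Static G s)
    (h9 : s.ireg 9 = w * n + v) (h10 : s.ireg 10 = e) :
    Wp (n * n + 3) (cells (n * n)) edgeTestCode (fun s' t' => (∀ x ≤ 8, s'.ireg x = s.ireg x) ∧
      s'.iarr = s.iarr ∧ s'.rarr = s.rarr ∧ s'.rreg 0 = G.len e ∧
      (s'.ireg 12 = 1 ↔ s.iarr 2 (w * n + v) = 0 ∨ G.len e < s.rarr 1 (w * n + v)) ∧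
      t' ≤ t + 30) s t := by
  refine Wp.of_vc ?_
  have i1 := idx_lt w v
  have i2 := e.2.trans_le G.m_le
  simp [edgeTestCode, vc, code, Instr.Safe, Instr.exec, Test.holds, h9, h10, hs.r2, hs.len]
  have key : ∀ a b, ∀ x ≤ 8, Function.update (Function.update s.ireg 11 a) 12 b x = s.ireg x :=
    fun a b x hx => by simp (disch := omega)
  exact ⟨i2, i1, fun h => ⟨fun h' => ⟨key _ _, .inl h⟩, fun h' => ⟨key _ _, .inl h⟩⟩,
    fun h => ⟨fun h' => ⟨key _ _, .inr h'⟩, fun h' => ⟨key _ _, h, h'⟩⟩⟩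

/-- In each row one of `insert_of_lt`, `insert_of_le` and `insert_of_not_reachable` passes from `W`
to `insert w W`. Only column `v` is written and `w ≠ v`, so the distances to `w` that are read stay
correct. -/
theorem relaxLoop_wp (hG : G.Acyclic) {s₀ : State} {t₀ : ℕ} {v w : Fin n} {e : Fin G.m}
    {W : Set (Fin n)}
    (h0 : Static G s₀) (h6 : s₀.ireg 6 = v) (h8 : s₀.ireg 8 = w) (h9 : s₀.ireg 9 = w + 1)
    (h10 : s₀.ireg 10 = 0) (hl : s₀.rreg 0 = G.len e) (hw : G.src e = w) (hv : G.tgt e = v)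
    (hw_entry : ∀ u, G.IsEntry (G.IsPath u w) (s₀.rarr 1 (u * n + w)) (s₀.iarr 2 (u * n + w)))
    (hv_entry : ∀ u, G.IsEntry (G.IsPathVia W u v) (s₀.rarr 1 (u * n + v))
      (s₀.iarr 2 (u * n + v))) :
    Wp (n * n + 3) (cells (n * n)) relaxLoop (fun s t => ColFrame 9 v s₀ s ∧
      (∀ u, G.IsEntry (G.IsPathVia (insert w W) u v) (s.rarr 1 (u * n + v))
        (s.iarr 2 (u * n + v))) ∧ t ≤ t₀ + 90 * n + 1) s₀ t₀ := by
  have hwv : w ≠ v := by rw [← hw, ← hv]; exact hG.src_ne_tgt e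
  refine Wp.loop n (fun k s t => s.ireg 10 = k ∧ s.rreg 0 = G.len e ∧
      ColFrame 9 v s₀ s ∧
      (∀ u : Fin n, (u : ℕ) < k → G.IsEntry (G.IsPathVia (insert w W) u v)
        (s.rarr 1 (u * n + v)) (s.iarr 2 (u * n + v))) ∧
      (∀ u : Fin n, k ≤ u → G.IsEntry (G.IsPathVia W u v)
        (s.rarr 1 (u * n + v)) (s.iarr 2 (u * n + v))) ∧
      t ≤ t₀ + 90 * k) ?_ ?_ ?_
  · exact ⟨h10, hl, .refl _, by simp, fun u _ => hv_entry u, by simp⟩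
  · rintro k hk s t ⟨h10, hl, hf, hnew, hold, ht⟩
    have hs := hf.static (by simp) h0
    refine ⟨by simpa [Test.holds, h10, hs.r0] using hk, ?_⟩
    obtain ⟨u, rfl⟩ : ∃ u : Fin n, (u : ℕ) = k := ⟨⟨k, hk⟩, rfl⟩
    have hold' := hold u le_rfl
    have huw := hw_entry u
    rw [← hf.icol u w hwv, ← hf.rcol u w hwv] at huw
    have h4 : n ≤ n * n := Nat.le_mul_self n
    -- The common end of all branches: only row `u` may have changed, and its entry is now one for
    -- `insert w W`.
    have finish : ∀ s₁ t₁, ColFrame 10 v s s₁ → s₁.rreg 0 = G.len e →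
        (∀ x : Fin n, x ≠ u → s₁.iarr 2 (x * n + v) = s.iarr 2 (x * n + v) ∧
          s₁.rarr 1 (x * n + v) = s.rarr 1 (x * n + v)) →
        G.IsEntry (G.IsPathVia (insert w W) u v) (s₁.rarr 1 (u * n + v)) (s₁.iarr 2 (u * n + v)) →
        t₁ ≤ t + 80 →
        Wp (n * n + 3) (cells (n * n)) (code [.add 10 10 3]) (fun s t => s.ireg 10 = u + 1 ∧
          s.rreg 0 = G.len e ∧ ColFrame 9 v s₀ s ∧
          (∀ x : Fin n, (x : ℕ) < u + 1 → G.IsEntry (G.IsPathVia (insert w W) x v)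
            (s.rarr 1 (x * n + v)) (s.iarr 2 (x * n + v))) ∧
          (∀ x : Fin n, (u : ℕ) + 1 ≤ x → G.IsEntry (G.IsPathVia W x v)
            (s.rarr 1 (x * n + v)) (s.iarr 2 (x * n + v))) ∧
          t ≤ t₀ + 90 * (u + 1)) s₁ t₁ := by
      intro s₁ t₁ hf₁ hl₁ hrow key ht₁
      have hs₁ := hf₁.static (by simp) hs
      refine Wp.of_vc ?_
      simp only [code, vc, Instr.Safe, Instr.exec, hf₁.ireg 10 le_rfl, h10, hs₁.r3]
      refine ⟨by omega, by simp, hl₁, ?_, fun x hx => ?_, fun x hx => ?_, by omega⟩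
      · refine hf.trans ((hf₁.mono (by simp)).trans (.of_eq (fun x hx => ?_) rfl rfl))
        simp (disch := omega)
      · by_cases hxu : x = u
        · subst hxu; exact key
        · rw [(hrow x hxu).1, (hrow x hxu).2]
          exact hnew x (lt_of_le_of_ne (by omega) fun h => hxu (Fin.ext h))
      · have hxu : x ≠ u := by rintro rfl; omega
        rw [(hrow x hxu).1, (hrow x hxu).2]
        exact hold x (by omega)
    refine Wp.seq ((reachCode_wp hs ((hf.ireg 6 (by simp)).trans h6)
      ((hf.ireg 8 (by simp)).trans h8) h10).mono ?_)
    rintro s₁ t₁ ⟨hf₁, h11, h13, h14, ht₁⟩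
    have hs₁ := (hf₁.colFrame (v := v)).static (by simp) hs
    have hreach : 0 < s₁.ireg 14 ↔ ∃ p, G.IsPath u w p := by
      rw [h14]
      constructor
      · rintro (rfl | h)
        · exact ⟨[], WDigraph.isPath_nil_iff.2 rfl⟩
        · by_contra h'
          exact h (huw.2 h')
      · intro h
        by_contra! h'
        -- Unrestricted paths are paths via all vertices, which makes `eq_nil_of_eq_zero`
        -- applicable.
        rw [← WDigraph.isPathVia_eq_isPath (W := Set.univ) (by simp)] at huw h
        rw [h'.2] at huw
        exact huw.eq_nil_of_eq_zero h'.1 h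
    refine Wp.seq (Wp.ite (fun hb => ?_) fun hb => ?_)
    · simp only [Test.holds, hs₁.r2] at hb
      have hp := hreach.1 hb
      -- Otherwise a path from `u` to `w` followed by `e` would be closed.
      have huv : u ≠ v := by
        rintro rfl
        obtain ⟨p, hp⟩ := hp
        have := hG u (p ++ [e]) (WDigraph.isPath_concat_iff.2 ⟨hw ▸ hp, hv⟩)
        simp at this
      refine Wp.seq ((compareCode_wp hs₁ h11 h13).mono ?_)
      rintro s₂ t₂ ⟨hf₂, h13, hr1, h12, ht₂⟩
      have hs₂ := (hf₂.colFrame (v := v)).static (by simp) hs₁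
      replace hf₂ := hf₁.trans hf₂
      rw [hf₁.rreg, hl, hf₁.iarr, hf₁.rarr] at h12
      rw [hf₁.rreg, hl, hf₁.rarr] at hr1
      have hl₂ := hf₂.rreg.trans hl
      refine Wp.ite (fun hb => ?_) fun hb => ?_
      · simp only [Test.holds, hs₂.r3] at hb
        have key := WDigraph.IsEntry.insert_of_lt hw hv huv hp huw hold' (h12.1 hb)
        refine Wp.of_vc ?_
        have i1 := idx_lt u v
        have h9 : s₂.ireg 9 = w + 1 :=
          (hf₂.ireg 9 (by simp)).trans ((hf.ireg 9 le_rfl).trans h9)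
        simp only [code, vc, Instr.Safe, Instr.exec, h13, h9, hr1, real_mem_cells, int_mem_cells]
        refine ⟨⟨by simp, i1⟩, ⟨by simp, i1⟩, finish _ _ ⟨hf₂.ireg, fun a ha => ?_, fun a ha => ?_,
          fun x y hy => ?_, fun x y hy => ?_⟩ hl₂ (fun x hx => ?_) ?_ (by omega)⟩
        · simp [ha, hf₂.iarr]
        · simp [ha, hf₂.rarr]
        · simp [Function.update_of_ne fun h => hy (idx_inj.1 h).2, hf₂.iarr]
        · simp [Function.update_of_ne fun h => hy (idx_inj.1 h).2, hf₂.rarr]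
        · simp [Function.update_of_ne fun h => hx (idx_inj.1 h).1, hf₂.iarr, hf₂.rarr]
        · simpa using key
      · simp only [Test.holds, hs₂.r3] at hb
        obtain ⟨hc0, hlt⟩ := not_or.1 fun h => hb (h12.2 h)
        have key := WDigraph.IsEntry.insert_of_le hw hv huw hc0 hlt hold'
        exact Wp.skip (finish _ _ hf₂.colFrame hl₂ (fun x _ => by simp [hf₂.iarr, hf₂.rarr])
          (by rwa [hf₂.iarr, hf₂.rarr]) (by omega))
    · simp only [Test.holds, hs₁.r2] at hb
      have key := hold'.insert_of_not_reachable hw hv fun h => hb (hreach.2 h)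
      exact Wp.skip (finish _ _ hf₁.colFrame (hf₁.rreg.trans hl)
        (fun x _ => by simp [hf₁.iarr, hf₁.rarr]) (by rwa [hf₁.iarr, hf₁.rarr]) (by omega))
  · rintro s t ⟨h10, hl, hf, hnew, hold, ht⟩
    have hs := hf.static (by simp) h0
    exact ⟨by simp [Test.holds, h10, hs.r0], hf, fun u => hnew u u.2, by omega⟩

/-- The alternative in the time bound is the source of `m* n`: linear time is spent only on an edge
that `mem_shortestEdges` certifies. A rejected edge costs constant time by `insert_of_not_lt`, and a
missing edge adds no paths. -/
theorem edgeCode_wp (hG : G.Acyclic) {s₀ : State} {t₀ : ℕ} {v w : Fin n} {W : Set (Fin n)}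
    (h0 : Static G s₀) (h6 : s₀.ireg 6 = v) (h8 : s₀.ireg 8 = w)
    (hW : ∀ f, G.tgt f = v → G.src f ≠ w → (∃ p, G.IsPath w (G.src f) p) → G.src f ∈ W)
    (hw_entry : ∀ u, G.IsEntry (G.IsPath u w) (s₀.rarr 1 (u * n + w)) (s₀.iarr 2 (u * n + w)))
    (hv_entry : ∀ u, G.IsEntry (G.IsPathVia W u v) (s₀.rarr 1 (u * n + v))
      (s₀.iarr 2 (u * n + v))) :
    Wp (n * n + 3) (cells (n * n)) edgeCode (fun s t => ColFrame 7 v s₀ s ∧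
      (∀ u, G.IsEntry (G.IsPathVia (insert w W) u v) (s.rarr 1 (u * n + v))
        (s.iarr 2 (u * n + v))) ∧
      (t ≤ t₀ + 70 ∨ ∃ e ∈ G.shortestEdges, G.src e = w ∧ G.tgt e = v ∧
        t ≤ t₀ + 70 + 90 * n)) s₀ t₀ := by
  have i1 := idx_lt w v
  have i2 := row_le w
  refine Wp.seq (Wp.of_vc ?_)
  by_cases he : ∃ e, G.src e = w ∧ G.tgt e = v
  · obtain ⟨e, hw, hv⟩ := he
    have hadj : s₀.iarr 3 (w * n + v) = e + 2 := by rw [← hw, ← hv]; exact h0.adj_edge e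
    simp [code, vc, Instr.Safe, Instr.exec, h6, h8, h0.r0, hadj]
    refine ⟨by omega, by omega, by omega, ?_⟩
    refine Wp.ite (fun _ => ?_) fun hb => absurd hb (by simp [Test.holds, h0.r3])
    refine Wp.seq (Wp.of_vc ?_)
    simp [vc, Instr.Safe, Instr.exec, h0.r3]
    refine Wp.seq ((edgeTestCode_wp (v := v) (w := w) (e := e)
      ?_ (by simp) (by simp)).mono ?_)
    · exact h0.congr (fun x hx => by simp (disch := omega)) rfl rfl
    rintro s t ⟨hr, hi, hd, hl, h12, ht⟩
    simp only at hi hd h12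
    replace hr : ∀ x ≤ 8, s.ireg x = s₀.ireg x := fun x hx => by
      rw [hr x hx]; simp (disch := omega)
    have hs : Static G s := h0.congr (fun x hx => hr x (by omega)) (by rw [hi]) (by rw [hd])
    refine Wp.ite (fun hb => ?_) fun hb => ?_
    · simp only [Test.holds, hs.r3] at hb
      have hmem := (hv_entry w).mem_shortestEdges hG hw hv hW (h12.1 hb)
      have h6' := (hr 6 (by simp)).trans h6
      have h8' := (hr 8 (by simp)).trans h8
      have h4 : n ≤ n * n := Nat.le_mul_self n
      have hwn := w.2
      refine Wp.seq (Wp.of_vc ?_)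
      simp [vc, Instr.Safe, Instr.exec, hs.r3, h8']
      refine ⟨by omega, ?_⟩
      refine (relaxLoop_wp (v := v) (w := w) (e := e) (W := W) hG
        ?_ ?_ ?_ ?_ ?_ ?_ hw hv ?_ ?_).mono ?_
      · exact hs.congr (fun x hx => by simp (disch := omega)) rfl rfl
      · simpa using h6'
      · simpa using h8'
      · simp
      · simp
      · exact hl
      · simpa [hi, hd] using hw_entry
      · simpa [hi, hd] using hv_entry
      · rintro s' t' ⟨hf, hent, ht'⟩
        refine ⟨.trans ?_ (hf.mono (by simp)), hent, .inr ⟨e, hmem, hw, hv, by omega⟩⟩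
        refine .of_eq (fun x hx => ?_) hi hd
        simp (disch := omega)
        exact hr x (by omega)
    · simp only [Test.holds, hs.r3] at hb
      obtain ⟨hc, hlt⟩ := not_or.1 fun h => hb (h12.2 h)
      refine Wp.skip ⟨.of_eq (fun x hx => hr x (by omega)) hi hd, fun u => ?_, .inl (by omega)⟩
      rw [hi, hd]
      exact (hv_entry w).insert_of_not_lt hw hv hc hlt (hv_entry u)
  · push Not at he
    have hadj := h0.adj_none w v he
    simp [code, vc, Instr.Safe, Instr.exec, h6, h8, h0.r0, hadj]
    refine ⟨by omega, by omega, by omega, ?_⟩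
    refine Wp.ite (fun hb => absurd hb (by simp [Test.holds, h0.r3])) fun _ => ?_
    refine Wp.skip ⟨.of_eq (fun x hx => ?_) rfl rfl, fun u => ?_, .inl (by omega)⟩
    · simp (disch := omega)
    · rw [WDigraph.isPathVia_insert_of_no_edge he]
      exact hv_entry u

/-- The index runs downwards, so that the in-neighbours treated before `q j` include all others
reachable from `q j`, as `edgeCode_wp` requires. The set `R` collects the edges that were relaxed.
-/
theorem inEdgeLoop_wp (hG : G.Acyclic) {s₀ : State} {t₀ i : ℕ} {v : Fin n} {q : ℕ → Fin n}
    (h0 : Static G s₀) (h6 : s₀.ireg 6 = v) (h7 : s₀.ireg 7 = i) (hi : i ≤ n)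
    (hord : ∀ k < i, s₀.iarr 6 k = q k) (hinj : ∀ j < i, ∀ k < i, q j = q k → j = k)
    (htopo : ∀ k < i, ∀ e, G.tgt e = q k → ∃ j < k, G.src e = q j)
    (hdone : ∀ k < i, ∀ u, G.IsEntry (G.IsPath u (q k)) (s₀.rarr 1 (u * n + q k))
      (s₀.iarr 2 (u * n + q k)))
    (hv : ∀ k < i, q k ≠ v) (hpred : ∀ e, G.tgt e = v → ∃ k < i, G.src e = q k)
    (hfresh : ∀ u : Fin n, s₀.iarr 2 (u * n + v) = 0 ∧ s₀.rarr 1 (u * n + v) = 0) :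
    Wp (n * n + 3) (cells (n * n)) inEdgeLoop (fun s t => ColFrame 6 v s₀ s ∧
      (∀ u, G.IsEntry (G.IsPath u v) (s.rarr 1 (u * n + v)) (s.iarr 2 (u * n + v))) ∧
      ∃ R : Finset (Fin G.m), (∀ e ∈ R, e ∈ G.shortestEdges ∧ G.tgt e = v) ∧
        t ≤ t₀ + 80 * i + 90 * (n * R.card) + 1) s₀ t₀ := by
  refine Wp.loop i (fun k s t => s.ireg 7 = i - k ∧ ColFrame 6 v s₀ s ∧
      (∀ u, G.IsEntry (G.IsPathVia {x | ∃ l, i - k ≤ l ∧ l < i ∧ q l = x} u v)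
        (s.rarr 1 (u * n + v)) (s.iarr 2 (u * n + v))) ∧
      ∃ R : Finset (Fin G.m), (∀ e ∈ R, e ∈ G.shortestEdges ∧ G.tgt e = v ∧
          ∃ l, i - k ≤ l ∧ l < i ∧ q l = G.src e) ∧
        t ≤ t₀ + 80 * k + 90 * (n * R.card)) ?_ ?_ ?_
  · refine ⟨by simp [h7], .refl _, fun u => ?_, ∅, by simp, by simp⟩
    rw [show {x | ∃ l, i - 0 ≤ l ∧ l < i ∧ q l = x} = ∅ by
      ext x; simp; intro l h h'; omega, (hfresh u).1]
    exact WDigraph.isEntry_empty (hfresh u).2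
  · rintro k hk s t ⟨h7, hf, hent, R, hR, ht⟩
    have hs := hf.static (by simp) h0
    refine ⟨by simp [Test.holds, h7, hs.r2, hk], Wp.seq (Wp.of_vc ?_)⟩
    obtain ⟨j, hj⟩ : ∃ j, i - k = j + 1 := ⟨i - k - 1, by omega⟩
    have hji : j < i := by omega
    have hj' : i - (k + 1) = j := by omega
    have h4 : n ≤ n * n := Nat.le_mul_self n
    have hload : s.iarr 6 j = q j := by rw [hf.iarr 6 (by simp), hord j hji]
    rw [hj] at h7 hent hR
    rw [hj']
    have hset : {x | ∃ l, j ≤ l ∧ l < i ∧ q l = x} =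
        insert (q j) {x | ∃ l, j + 1 ≤ l ∧ l < i ∧ q l = x} := by
      ext x
      simp only [Set.mem_ofPred_eq, Set.mem_insert_iff]
      constructor
      · rintro ⟨l, h₁, h₂, rfl⟩
        rcases h₁.eq_or_lt with rfl | h₁
        · exact .inl rfl
        · exact .inr ⟨l, h₁, h₂, rfl⟩
      · rintro (rfl | ⟨l, h₁, h₂, rfl⟩)
        · exact ⟨j, le_rfl, hji, rfl⟩
        · exact ⟨l, by omega, h₂, rfl⟩
    simp [code, vc, Instr.Safe, Instr.exec, h7, hs.r3, hload]
    refine ⟨by omega, ?_⟩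
    refine (edgeCode_wp (v := v) (w := q j)
      (W := {x | ∃ l, j + 1 ≤ l ∧ l < i ∧ q l = x}) hG
      ?_ ?_ ?_ ?_ ?_ ?_).mono ?_
    · exact hs.congr (fun x hx => by simp (disch := omega)) rfl rfl
    · simp [hf.ireg 6 le_rfl, h6]
    · simp
    -- A path from `q j` to the source `q l` of `f` forces `j ≤ l`, and `j ≠ l` because the sources
    -- differ.
    · rintro f hf hfj ⟨p, hp⟩
      obtain ⟨l, hl, hl'⟩ := hpred f hf
      obtain ⟨a, ha, ha'⟩ := WDigraph.exists_le_of_isPath htopo hp hl hl'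
      obtain rfl := hinj j hji a (by omega) ha'
      refine ⟨l, ?_, hl, hl'.symm⟩
      rcases ha.eq_or_lt with rfl | h
      · exact absurd hl' hfj
      · exact h
    · intro u
      have := hdone j hji u
      rw [← hf.icol u (q j) (hv j hji), ← hf.rcol u (q j) (hv j hji)] at this
      simpa using this
    · simpa using hent
    · rintro s' t' ⟨hf', hent', ht'⟩
      refine ⟨?_, hf.trans (.trans ?_ (hf'.mono (by simp))), ?_, ?_⟩
      · rw [hf'.ireg 7 le_rfl]; simp
      · exact .of_eq (fun x hx => by simp (disch := omega)) rfl rfl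
      · rw [hset]; exact hent'
      · rcases ht' with ht' | ⟨e, he, hw, hv', ht'⟩
        · refine ⟨R, fun f hf => ?_, by omega⟩
          obtain ⟨h₁, h₂, l, h₃, h₄, h₅⟩ := hR f hf
          exact ⟨h₁, h₂, l, by omega, h₄, h₅⟩
        -- The sources of the edges in `R` have positions above `j`, so `e` is charged for the first
        -- time.
        · have heR : e ∉ R := by
            intro h
            obtain ⟨-, -, l, h₃, h₄, h₅⟩ := hR e h
            have := hinj l h₄ j hji (h₅.trans hw)
            omega
          refine ⟨insert e R, fun f hf => ?_, ?_⟩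
          · rcases Finset.mem_insert.1 hf with rfl | hf
            · exact ⟨he, hv', j, le_rfl, hji, hw.symm⟩
            · obtain ⟨h₁, h₂, l, h₃, h₄, h₅⟩ := hR f hf
              exact ⟨h₁, h₂, l, by omega, h₄, h₅⟩
          · have := Nat.mul_add_one n R.card
            rw [Finset.card_insert_of_notMem heR]
            omega
  · rintro s t ⟨h7, hf, hent, R, hR, ht⟩
    have hs := hf.static (by simp) h0
    refine ⟨by simp [Test.holds, h7, hs.r2], hf, fun u => ?_, R,
      fun e he => ⟨(hR e he).1, (hR e he).2.1⟩, by omega⟩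
    -- All in-neighbours of `v` have been treated, so the restriction on the last edge is void.
    rw [← WDigraph.isPathVia_eq_isPath]
    · exact hent u
    · intro e he
      obtain ⟨k, hk, hk'⟩ := hpred e he
      exact ⟨k, by omega, hk, hk'.symm⟩

/-- At most one edge leads from `v` to `w`, so a single decrement accounts for the placement of `v`.
-/
theorem countLoop_wp {s₀ : State} {t₀ : ℕ} {v : Fin n} (h0 : Static G s₀)
    (h7 : s₀.ireg 7 = 0) (h8 : s₀.ireg 8 = v * n) :
    Wp (n * n + 3) (cells (n * n)) countLoop (fun s t => (∀ x ≤ 6, s.ireg x = s₀.ireg x) ∧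
      (∀ a, a ≠ 4 → s.iarr a = s₀.iarr a) ∧ s.rarr = s₀.rarr ∧
      (∀ w : Fin n, (∃ e, G.src e = v ∧ G.tgt e = w) → s.iarr 4 w = s₀.iarr 4 w - 1) ∧
      (∀ w : Fin n, (¬ ∃ e, G.src e = v ∧ G.tgt e = w) → s.iarr 4 w = s₀.iarr 4 w) ∧
      t ≤ t₀ + 40 * n + 1) s₀ t₀ := by
  refine Wp.loop n (fun k s t => s.ireg 7 = k ∧ s.ireg 8 = v * n ∧
      (∀ x ≤ 6, s.ireg x = s₀.ireg x) ∧
      (∀ a, a ≠ 4 → s.iarr a = s₀.iarr a) ∧ s.rarr = s₀.rarr ∧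
      (∀ w : Fin n, (w : ℕ) < k → (∃ e, G.src e = v ∧ G.tgt e = w) →
        s.iarr 4 w = s₀.iarr 4 w - 1) ∧
      (∀ w : Fin n, (k ≤ w ∨ ¬ ∃ e, G.src e = v ∧ G.tgt e = w) → s.iarr 4 w = s₀.iarr 4 w) ∧
      t ≤ t₀ + 40 * k) ?_ ?_ ?_
  · exact ⟨h7, h8, by simp, by simp, rfl, by simp, by simp, by simp⟩
  · rintro k hk s t ⟨h7, h8, hr, ha, hra, hdec, hsame, ht⟩
    have hs : Static G s := h0.congr (fun x hx => hr x (by omega)) (ha 3 (by simp)) (by rw [hra])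
    refine ⟨by simpa [Test.holds, h7, hs.r0] using hk, Wp.of_vc ?_⟩
    obtain ⟨w, rfl⟩ : ∃ w : Fin n, (w : ℕ) = k := ⟨⟨k, hk⟩, rfl⟩
    have h4 : n ≤ n * n := Nat.le_mul_self n
    have i1 := idx_lt v w
    by_cases he : ∃ e, G.src e = v ∧ G.tgt e = w
    · have hadj : ∃ e : Fin G.m, s.iarr 3 (v * n + w) = e + 2 := by
        obtain ⟨e, rfl, rfl⟩ := he
        exact ⟨e, hs.adj_edge e⟩
      obtain ⟨e, hadj⟩ := hadj
      simp [code, vc, Instr.Safe, Instr.exec, Test.holds, h7, h8, hs.r3, hadj, hra]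
      refine ⟨by omega, by omega, by omega, by omega, fun x hx => ?_, fun a ha' => ?_,
        fun x hx e' h₁ h₂ => ?_, fun x hx => ?_, by omega⟩
      · simp (disch := omega) [hr]
      · simp [ha', ha]
      · by_cases hxw : x = w
        · subst hxw; simp [hsame x (.inl le_rfl)]
        · have hxw' : (x : ℕ) ≠ w := fun h => hxw (Fin.ext h)
          rw [Function.update_of_ne hxw', hdec x (by omega) ⟨e', h₁, h₂⟩]
      · have hxw' : (x : ℕ) ≠ w := by
          intro h
          obtain rfl := Fin.ext h
          rcases hx with hx | hx
          · omega
          · obtain ⟨e', h₁, h₂⟩ := he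
            exact hx e' h₁ h₂
        rw [Function.update_of_ne hxw', hsame x (hx.imp (fun h => by omega) (by simpa using ·))]
    · have hadj := hs.adj_none v w (by simpa using he)
      simp [code, vc, Instr.Safe, Instr.exec, Test.holds, h7, h8, hs.r3, hadj, hra]
      refine ⟨by omega, by omega, by omega, fun x hx => ?_, fun a ha' => ha a ha',
        fun x hx e' h₁ h₂ => ?_, fun x hx => ?_, by omega⟩
      · simp (disch := omega) [hr]
      · refine hdec x (lt_of_le_of_ne (by omega) fun h => he ?_) ⟨e', h₁, h₂⟩
        obtain rfl := Fin.ext h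
        exact ⟨e', h₁, h₂⟩
      · exact hsame x (hx.imp (fun h => by omega) (by simpa using ·))
  · rintro s t ⟨h7, h8, hr, ha, hra, hdec, hsame, ht⟩
    exact ⟨by simp [Test.holds, h7, hr, h0.r0], hr, ha, hra, fun w => hdec w w.2,
      fun w hw => hsame w (.inr hw), by omega⟩

/-! ### Topological order and the main loop -/

/-- The vertices placed in the first `i` rounds. -/
def placed (q : ℕ → Fin n) (i : ℕ) : Set (Fin n) := {x | ∃ k < i, q k = x}

/-- The number of edges from vertices outside `S` to `v`. -/
noncomputable def pending (G : WDigraph n) (S : Set (Fin n)) (v : Fin n) : ℕ :=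
  Set.ncard {e : Fin G.m | G.tgt e = v ∧ G.src e ∉ S}

theorem pending_eq_zero_iff {S : Set (Fin n)} {v : Fin n} :
    pending G S v = 0 ↔ ∀ e, G.tgt e = v → G.src e ∈ S := by
  rw [pending, Set.ncard_eq_zero (Set.toFinite _), Set.eq_empty_iff_forall_notMem]
  simp

theorem pending_insert_of_edge {S : Set (Fin n)} {v w : Fin n} (hv : v ∉ S)
    (he : ∃ e, G.src e = v ∧ G.tgt e = w) : pending G (insert v S) w = pending G S w - 1 := by
  obtain ⟨e, rfl, rfl⟩ := he
  have hmem : e ∈ {f : Fin G.m | G.tgt f = G.tgt e ∧ G.src f ∉ S} := ⟨rfl, hv⟩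
  rw [pending, pending, ← Set.ncard_sdiff_singleton_of_mem hmem]
  congr 1
  ext f
  simp only [Set.mem_ofPred_eq, Set.mem_insert_iff, not_or, Set.mem_sdiff, Set.mem_singleton_iff]
  constructor
  · rintro ⟨h₁, h₂, h₃⟩
    exact ⟨⟨h₁, h₃⟩, fun h => h₂ (by rw [h])⟩
  · rintro ⟨⟨h₁, h₂⟩, h₃⟩
    exact ⟨h₁, fun h => h₃ (G.simple _ _ h h₁), h₂⟩

theorem pending_insert_of_no_edge {S : Set (Fin n)} {v w : Fin n}
    (he : ¬ ∃ e, G.src e = v ∧ G.tgt e = w) : pending G (insert v S) w = pending G S w := by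
  rw [pending, pending]
  congr 1
  ext f
  simp only [Set.mem_ofPred_eq, Set.mem_insert_iff, not_or]
  exact ⟨fun ⟨h₁, h₂, h₃⟩ => ⟨h₁, h₃⟩, fun ⟨h₁, h₃⟩ => ⟨h₁, fun h => he ⟨f, h, h₁⟩, h₃⟩⟩

open Classical in
/-- The invariant of the main loop: the vertices `q 0, …, q (i - 1)` are the first `i` vertices in a
topological order, and their columns of the output matrices are correct. -/
structure MainInv (G : WDigraph n) (i : ℕ) (q : ℕ → Fin n) (s : State) : Prop where
  static : Static G s
  r5 : s.ireg 5 = i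
  ord : ∀ k < i, s.iarr 6 k = q k
  inj : ∀ j < i, ∀ k < i, q j = q k → j = k
  topo : ∀ k < i, ∀ e, G.tgt e = q k → ∃ j < k, G.src e = q j
  count : ∀ v : Fin n, s.iarr 4 v = pending G (placed q i) v + if v ∈ placed q i then 1 else 0
  done : ∀ k < i, ∀ u, G.IsEntry (G.IsPath u (q k)) (s.rarr 1 (u * n + q k))
    (s.iarr 2 (u * n + q k))
  fresh : ∀ v ∉ placed q i, ∀ u : Fin n, s.iarr 2 (u * n + v) = 0 ∧ s.rarr 1 (u * n + v) = 0

theorem exists_notMem_placed (q : ℕ → Fin n) {i : ℕ} (hi : i < n) : ∃ v, v ∉ placed q i := by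
  by_contra! h
  have hsurj : Function.Surjective fun k : Fin i => q k := fun x => by
    obtain ⟨k, hk, hk'⟩ := h x
    exact ⟨⟨k, hk⟩, hk'⟩
  have := Fintype.card_le_of_surjective _ hsurj
  simp at this
  omega

/-- A vertex with counter `0` is unplaced and has only placed predecessors, so it may come next in
the topological order. The in-edge loop completes its column, and the counting loop restores the
meaning of the counters. -/
theorem MainInv.step_wp (hG : G.Acyclic) {s : State} {t i : ℕ} {q : ℕ → Fin n}
    (h : MainInv G i q s) (hi : i < n) :
    Wp (n * n + 3) (cells (n * n))
      (code [.const 7 0] ;; findLoop ;; code [.store 6 5 6, .store 4 6 3, .move 7 5] ;;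
        inEdgeLoop ;; code [.const 7 0, .mul 8 6 0] ;; countLoop ;; code [.add 5 5 3])
      (fun s' t' => ∃ v ∉ placed q i, MainInv G (i + 1) (Function.update q i v) s' ∧
        ∃ R : Finset (Fin G.m), (∀ e ∈ R, e ∈ G.shortestEdges ∧ G.tgt e = v) ∧
          t' ≤ t + 200 * n + 90 * (n * R.card)) s t := by
  have h4 : n ≤ n * n := Nat.le_mul_self n
  refine Wp.seq (Wp.of_vc ?_)
  simp only [code, vc, Instr.Safe, Instr.exec]
  refine ⟨by omega, ?_⟩
  refine Wp.seq ((findLoop_wp (n := n) (G := G) ?_ (by simp) ?_).mono ?_)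
  · exact h.static.congr (fun x hx => by simp (disch := omega)) rfl rfl
  · obtain ⟨v, hv, hpred⟩ := hG.exists_source (placed q i) (exists_notMem_placed q hi)
    refine ⟨v, ?_⟩
    simp only
    rw [h.count, pending_eq_zero_iff.2 hpred, if_neg hv]
  rintro s₁ t₁ ⟨hr₁, hi₁, hd₁, ⟨v, h6, hv0⟩, ht₁⟩
  simp only at hi₁ hd₁ hv0
  replace hr₁ : ∀ x ≤ 5, s₁.ireg x = s.ireg x := fun x hx => by
    rw [hr₁ x hx]; simp (disch := omega)
  have hs₁ : Static G s₁ := h.static.congr (fun x hx => hr₁ x (by omega)) (by rw [hi₁]) (by rw [hd₁])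
  have h5 : s₁.ireg 5 = i := (hr₁ 5 le_rfl).trans h.r5
  rw [h.count, Nat.add_eq_zero_iff, pending_eq_zero_iff] at hv0
  obtain ⟨hpred, hv⟩ := hv0
  replace hv : v ∉ placed q i := fun h => by simp [h] at hv
  have hvk : ∀ k < i, q k ≠ v := fun k hk hk' => hv ⟨k, hk, hk'⟩
  have hvn := v.2
  refine Wp.seq (Wp.of_vc ?_)
  simp [vc, Instr.Safe, Instr.exec, h5, h6, hs₁.r3]
  refine ⟨by omega, by omega, ?_⟩
  have hne : ∀ k < i, k ≠ i := fun k hk => hk.ne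
  refine Wp.seq ((inEdgeLoop_wp (v := v) (q := q) (i := i) hG ?_ ?_ ?_ hi.le ?_ h.inj h.topo ?_
    hvk ?_ ?_).mono ?_)
  · exact hs₁.congr (fun x hx => by simp (disch := omega)) (by simp) rfl
  · simpa using h6
  · simp
  · intro k hk
    simp [hne k hk, hi₁, h.ord k hk]
  · intro k hk u
    simpa [hi₁, hd₁] using h.done k hk u
  · intro e he
    obtain ⟨k, hk, hk'⟩ := hpred e he
    exact ⟨k, hk, hk'.symm⟩
  · intro u
    simpa [hi₁, hd₁] using h.fresh v hv u
  rintro s₂ t₂ ⟨hf, hent, R, hR, ht₂⟩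
  have hs₂ : Static G s₂ := by
    refine hf.static (by simp) ?_
    exact hs₁.congr (fun x hx => by simp (disch := omega)) (by simp) rfl
  have h5₂ : s₂.ireg 5 = i := by rw [hf.ireg 5 (by simp)]; simpa using h5
  have h6₂ : s₂.ireg 6 = v := by rw [hf.ireg 6 (by simp)]; simpa using h6
  have hord₂ : ∀ k < i + 1, s₂.iarr 6 k = Function.update q i v k := by
    intro k hk
    rw [hf.iarr 6 (by simp)]
    by_cases hki : k = i
    · subst hki; simp
    · simp [hki, hi₁, h.ord k (by omega)]
  have hcount₂ : ∀ w : Fin n, s₂.iarr 4 w = if w = v then 1 else s.iarr 4 w := by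
    intro w
    rw [hf.iarr 4 (by simp)]
    simp [Function.update_apply, hi₁, Fin.ext_iff]
  have hicol : ∀ u x : Fin n, x ≠ v → s₂.iarr 2 (u * n + x) = s.iarr 2 (u * n + x) := by
    intro u x hx
    rw [hf.icol u x hx]; simp [hi₁]
  have hrcol : ∀ u x : Fin n, x ≠ v → s₂.rarr 1 (u * n + x) = s.rarr 1 (u * n + x) := by
    intro u x hx
    rw [hf.rcol u x hx]; simp [hd₁]
  clear hf
  have i3 := row_le v
  refine Wp.seq (Wp.of_vc ?_)
  simp [vc, Instr.Safe, Instr.exec, h6₂, hs₂.r0]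
  refine ⟨by omega, ?_⟩
  refine Wp.seq ((countLoop_wp (n := n) (G := G) (v := v) ?_ (by simp) (by simp)).mono ?_)
  · exact hs₂.congr (fun x hx => by simp (disch := omega)) rfl rfl
  rintro s₃ t₃ ⟨hr₃, hi₃, hd₃, hdec, hsame, ht₃⟩
  simp only at hi₃ hd₃ hdec hsame
  replace hr₃ : ∀ x ≤ 6, s₃.ireg x = s₂.ireg x := fun x hx => by
    rw [hr₃ x hx]; simp (disch := omega)
  have hs₃ : Static G s₃ :=
    hs₂.congr (fun x hx => hr₃ x (by omega)) (hi₃ 3 (by simp)) (by rw [hd₃])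
  have hplaced : placed (Function.update q i v) (i + 1) = insert v (placed q i) := by
    ext x
    simp only [placed, Set.mem_ofPred_eq, Set.mem_insert_iff]
    constructor
    · rintro ⟨k, hk, rfl⟩
      by_cases hki : k = i
      · subst hki; simp
      · exact .inr ⟨k, by omega, by simp [hki]⟩
    · rintro (rfl | ⟨k, hk, rfl⟩)
      · exact ⟨i, by simp, by simp⟩
      · exact ⟨k, by omega, by simp [hk.ne]⟩
  refine Wp.of_vc ?_
  simp only [vc, Instr.Safe, Instr.exec, hr₃ 5 (by simp), h5₂, hs₃.r3]
  refine ⟨by omega, v, hv, ⟨?_, by simp, fun k hk => ?_, fun j hj k hk hjk => ?_,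
    fun k hk e he => ?_, fun w => ?_, fun k hk u => ?_, fun x hx u => ?_⟩, R, hR, by omega⟩
  · exact hs₃.congr (fun x hx => by simp (disch := omega)) rfl rfl
  · simp only [hi₃ 6 (by simp)]
    exact hord₂ k hk
  · by_cases hj' : j = i <;> by_cases hk' : k = i
    · rw [hj', hk']
    · rw [hj', Function.update_self, Function.update_of_ne hk'] at hjk
      exact absurd hjk.symm (hvk k (by omega))
    · rw [hk', Function.update_self, Function.update_of_ne hj'] at hjk
      exact absurd hjk (hvk j (by omega))
    · rw [Function.update_of_ne hj', Function.update_of_ne hk'] at hjk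
      exact h.inj j (by omega) k (by omega) hjk
  · by_cases hk' : k = i
    · rw [hk', Function.update_self] at he
      obtain ⟨j, hj, hj'⟩ := hpred e he
      exact ⟨j, by omega, by rw [Function.update_of_ne hj.ne, hj']⟩
    · rw [Function.update_of_ne hk'] at he
      obtain ⟨j, hj, hj'⟩ := h.topo k (by omega) e he
      exact ⟨j, hj, by rw [Function.update_of_ne (by omega), hj']⟩
  · simp only
    have hwmem : w ∈ insert v (placed q i) ↔ w = v ∨ w ∈ placed q i := Iff.rfl
    rw [hplaced]
    by_cases he : ∃ e, G.src e = v ∧ G.tgt e = w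
    · have hwv : w ≠ v := by
        obtain ⟨e, rfl, rfl⟩ := he; exact (hG.src_ne_tgt e).symm
      -- Were the successor `w` of `v` already placed, the topological order would have placed `v`
      -- before it.
      have hwp : w ∉ placed q i := by
        rintro ⟨k, hk, rfl⟩
        obtain ⟨e, he, he'⟩ := he
        obtain ⟨j, hj, hj'⟩ := h.topo k hk e he'
        exact hvk j (by omega) (hj'.symm.trans he)
      rw [hdec w he, hcount₂, if_neg hwv, h.count, pending_insert_of_edge hv he, if_neg hwp, if_neg]
      · rfl
      · rw [hwmem]; exact not_or.2 ⟨hwv, hwp⟩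
    · rw [hsame w he, hcount₂, pending_insert_of_no_edge he]
      by_cases hwv : w = v
      · subst hwv
        rw [if_pos rfl, if_pos (hwmem.2 (.inl rfl)), pending_eq_zero_iff.2 hpred]
      · rw [if_neg hwv, h.count]
        by_cases hwp : w ∈ placed q i
        · rw [if_pos hwp, if_pos (hwmem.2 (.inr hwp))]
        · rw [if_neg hwp, if_neg fun h' => (hwmem.1 h').elim hwv hwp]
  · simp only [hd₃, hi₃ 2 (by simp)]
    by_cases hk' : k = i
    · rw [hk', Function.update_self]; exact hent u
    · rw [Function.update_of_ne hk', hicol u _ (hvk k (by omega)), hrcol u _ (hvk k (by omega))]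
      exact h.done k (by omega) u
  · simp only [hd₃, hi₃ 2 (by simp)]
    rw [hplaced, Set.mem_insert_iff, not_or] at hx
    rw [hicol u x hx.1, hrcol u x hx.1]
    exact h.fresh x hx.2 u

/-- The edges relaxed in one round all end in the vertex placed in that round. Different rounds
therefore relax disjoint sets of edges, and in total at most `m*` relaxations of length `n` take
place. -/
theorem mainLoop_wp (hG : G.Acyclic) {s₀ : State} {t₀ : ℕ} {q₀ : ℕ → Fin n}
    (h : MainInv G 0 q₀ s₀) :
    Wp (n * n + 3) (cells (n * n)) mainLoop (fun s t => Static G s ∧ CorrectOutput G s ∧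
      t ≤ t₀ + 210 * (n * n) + 90 * (n * G.mStar) + 1) s₀ t₀ := by
  refine Wp.loop n (fun i s t => ∃ q, MainInv G i q s ∧ ∃ R : Finset (Fin G.m),
    (∀ e ∈ R, e ∈ G.shortestEdges ∧ G.tgt e ∈ placed q i) ∧
      t ≤ t₀ + 210 * (n * i) + 90 * (n * R.card)) ?_ ?_ ?_
  · exact ⟨q₀, h, ∅, by simp, by simp⟩
  · rintro i hi s t ⟨q, h, R, hR, ht⟩
    refine ⟨by simp [Test.holds, h.r5, h.static.r0, hi], (h.step_wp hG hi).mono ?_⟩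
    rintro s' t' ⟨v, hv, h', R', hR', ht'⟩
    have hdisj : Disjoint R R' := Finset.disjoint_left.2 fun e he he' =>
      hv ((hR' e he').2 ▸ (hR e he).2)
    refine ⟨_, h', R ∪ R', fun e he => ?_, ?_⟩
    · rcases Finset.mem_union.1 he with he | he
      · obtain ⟨h₁, k, hk, hk'⟩ := hR e he
        exact ⟨h₁, k, by omega, by rw [Function.update_of_ne hk.ne, hk']⟩
      · exact ⟨(hR' e he).1, i, by simp, by simp [(hR' e he).2]⟩
    · have h₁ := Nat.mul_add n R.card R'.card
      have h₂ := Nat.mul_add_one n i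
      rw [Finset.card_union_of_disjoint hdisj]
      omega
  · rintro s t ⟨q, h, R, hR, ht⟩
    refine ⟨by simp [Test.holds, h.r5, h.static.r0], h.static, fun u v => ?_, ?_⟩
    -- The `n` placed vertices are distinct, so every `v` is among them.
    · have hinj : Function.Injective fun k : Fin n => q k := fun j k hjk =>
        Fin.ext (h.inj j j.2 k k.2 hjk)
      obtain ⟨k, rfl⟩ := (Finite.injective_iff_surjective.1 hinj) v
      obtain ⟨h₁, h₂⟩ := h.done k k.2 u
      exact ⟨h₁, h₂⟩
    · have hcard : R.card ≤ G.mStar := by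
        rw [← Set.ncard_coe_finset]
        exact Set.ncard_le_ncard (fun e he => (hR e he).1) (Set.toFinite _)
      have := Nat.mul_le_mul_left n hcard
      omega

/-- No vertex is placed yet, so `q` is arbitrary and the pending edges into `v` are all its
in-edges. -/
theorem initCode_wp (q : ℕ → Fin n) (t₀ : ℕ) :
    Wp (n * n + 3) (cells (n * n)) initCode (fun s t => MainInv G 0 q s ∧
      t ≤ t₀ + 50 * (n * n) + 40) (inputState G) t₀ := by
  have hm := G.m_le
  refine Wp.seq (Wp.of_vc ?_)
  simp [code, vc, Instr.Safe, Instr.exec, inputState]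
  refine Wp.seq ((fillLoop_wp (n := n) (by simp) (by simp) (by simp)).mono ?_)
  rintro s₁ t₁ ⟨hr₁, hi₁, hd₁, hfill, ht₁⟩
  simp only at hr₁ hi₁ hd₁
  have h0 : s₁.ireg 0 = n := by rw [hr₁ 0 (by simp)]; simp
  have h1 : s₁.ireg 1 = G.m := by rw [hr₁ 1 (by simp)]; simp
  have h2 : s₁.ireg 2 = 0 := by rw [hr₁ 2 (by simp)]; simp
  have h3 : s₁.ireg 3 = 1 := by rw [hr₁ 3 (by simp)]; simp
  refine Wp.seq (Wp.of_vc ?_)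
  simp [vc, Instr.Safe, Instr.exec]
  refine Wp.seq ((edgeLoop_wp (G := G) (by simpa using h0) (by simpa using h1) (by simpa using h3)
    (by simp) ?_ ?_ ?_ ?_).mono ?_)
  · intro e; simp [hi₁]
  · intro e; simp [hi₁]
  · exact hfill
  · intro i; simp [hi₁]
  rintro s₂ t₂ ⟨hr₂, hi₂, hd₂, hadj, hno, hcount, ht₂⟩
  replace hr₂ : ∀ x ≤ 4, s₂.ireg x = s₁.ireg x := fun x hx => by
    rw [hr₂ x hx]; simp (disch := omega)
  simp only at hi₂ hd₂
  refine Wp.of_vc ?_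
  simp only [vc, Instr.Safe, Instr.exec]
  have hp : placed q 0 = ∅ := by simp [placed]
  refine ⟨by omega, ⟨⟨?_, ?_, ?_, fun e => ?_, hadj, hno⟩, by simp, by simp, by simp, by simp,
    fun v => ?_, by simp, fun v _ u => ?_⟩, by omega⟩
  · simpa [hr₂] using h0
  · simpa [hr₂] using h2
  · simpa [hr₂] using h3
  · simp [hd₂, hd₁]
  · simp only [hp, hcount]
    simp [pending, ← Set.ncard_coe_finset]
  · simp [hi₂, hi₁, hd₂, hd₁]

/-! ### Word size and number of cells -/

theorem inputState_intsBelow : (inputState G).IntsBelow (n * n + 3) := by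
  have hm := G.m_le
  have h4 : n ≤ n * n := Nat.le_mul_self n
  refine ⟨fun x => ?_, fun a i => ?_⟩
  · simp only [inputState]
    split_ifs <;> omega
  · simp only [inputState]
    split_ifs with h
    · have := (G.src ⟨i, h⟩).2; omega
    · have := (G.tgt ⟨i, h⟩).2; omega
    all_goals omega

/-- Eight integer and eight real arrays give the factor `16`. Finiteness is recorded because
`Set.ncard` is monotone only under finite supersets. -/
theorem ncard_cells_le (N : ℕ) : (cells N).Finite ∧ (cells N).ncard ≤ 16 * N := by
  classical
  let F : Finset Cell :=
    (Finset.range 8 ×ˢ Finset.range N).image (fun p => Cell.int p.1 p.2) ∪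
      (Finset.range 8 ×ˢ Finset.range N).image (fun p => Cell.real p.1 p.2)
  have hF : F.card ≤ 16 * N := by
    refine (Finset.card_union_le _ _).trans ?_
    refine (add_le_add Finset.card_image_le Finset.card_image_le).trans ?_
    simp; omega
  have hsub : cells N ⊆ F := by
    rintro (⟨a, i⟩ | ⟨a, i⟩) hc
    · simpa [F] using hc
    · simpa [F] using hc
  refine ⟨F.finite_toSet.subset hsub, ?_⟩
  refine (Set.ncard_le_ncard hsub F.finite_toSet).trans ?_
  rwa [Set.ncard_coe_finset]

end DagApsp

/-! ### Assembling the bounds on time and space -/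

theorem theorem4 :
    ∃ (P : DagApsp.Prog) (C : ℕ),
      ∀ (n : ℕ) (_hn : 1 ≤ n) (G : DagApsp.WDigraph n) (_hG : G.Acyclic),
        ∃ T : ℕ,
          -- the program halts and has computed all shortest paths
          DagApsp.HaltsIn P (DagApsp.inputState G) T ∧
          DagApsp.CorrectOutput G (DagApsp.run P (DagApsp.inputState G) T).2 ∧
          -- all integers that occur have `O(lg n)` bits
          (∀ t ≤ T, (DagApsp.run P (DagApsp.inputState G) t).2.IntsBelow ((n + 1) ^ C)) ∧
          -- time
          (2 ≤ n → G.WeaklyConnected →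
            (T : ℝ) ≤ C * ((G.mStar : ℝ) * n + (G.m : ℝ) * Real.logb 2 n)) ∧
          (T : ℝ) ≤ C * (((G.mStar : ℝ) + n) * n + (G.m : ℝ) * Real.logb 2 n) ∧
          -- space
          DagApsp.space P (DagApsp.inputState G) T ≤ C * n ^ 2 ∧
          n ^ 2 ≤ C * DagApsp.space P (DagApsp.inputState G) T := by
  -- One generous constant serves as the factor for time and space and as the exponent for the word
  -- size, where `3` would do.
  refine ⟨DagApsp.apsp, 2000, fun n hn G hG => ?_⟩
  have hwp : DagApsp.Wp (n * n + 3) (DagApsp.cells (n * n)) DagApsp.apsp (fun s t =>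
      DagApsp.Static G s ∧ DagApsp.CorrectOutput G s ∧
        t ≤ 400 * (n * n) + 90 * (n * G.mStar)) (DagApsp.inputState G) 0 := by
    have hn2 : 1 ≤ n * n := Nat.mul_pos hn hn
    refine DagApsp.Wp.seq ((DagApsp.initCode_wp (fun _ => ⟨0, hn⟩) _).mono fun s t h =>
      (DagApsp.mainLoop_wp hG h.1).mono fun s' t' h' => ⟨h'.1, h'.2.1, ?_⟩)
    have := h.2
    have := h'.2.2
    omega
  obtain ⟨T, hhalt, ⟨hstatic, hcorrect, htime⟩, hints, hcells⟩ :=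
    hwp.run (DagApsp.inputState_intsBelow)
  -- The time bound is met without the logarithmic term, which only has to be nonnegative.
  have hlog : 0 ≤ (G.m : ℝ) * Real.logb 2 n :=
    mul_nonneg (Nat.cast_nonneg _) (Real.logb_nonneg (by norm_num) (by exact_mod_cast hn))
  refine ⟨T, hhalt, hcorrect, fun t ht => ?_, fun hn2 hconn => ?_, ?_, ?_, ?_⟩
  · have hB : ∀ C, 3 ≤ C → n * n + 3 ≤ (n + 1) ^ C := fun C hC =>
      calc n * n + 3 ≤ (n + 1) ^ 3 := by nlinarith
        _ ≤ (n + 1) ^ C := Nat.pow_le_pow_right (by omega) hC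
    replace hB := hB 2000 (by norm_num)
    exact ⟨fun x => ((hints t ht).1 x).trans_le hB, fun a i => ((hints t ht).2 a i).trans_le hB⟩
  -- The correct output itself shows that shortest paths exist. As `n ≥ 2` forces `m* ≥ 1`, it
  -- follows that `n ≤ 2 m*`, and `n²` is absorbed by `m* n`.
  · have hm : n ≤ G.mStar + 1 := hconn.le_mStar hn fun u v huv =>
      let ⟨p, hp, _⟩ := (hcorrect u v).1 huv
      ⟨p, hp⟩
    have hT : T ≤ 2000 * (G.mStar * n) := by nlinarith
    have hT' : (T : ℝ) ≤ 2000 * ((G.mStar : ℝ) * n) := by exact_mod_cast hT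
    push_cast
    linarith
  · have hT : T ≤ 2000 * ((G.mStar + n) * n) := by nlinarith
    have hT' : (T : ℝ) ≤ 2000 * (((G.mStar : ℝ) + n) * n) := by exact_mod_cast hT
    push_cast
    linarith
  · obtain ⟨hfin, hcard⟩ := DagApsp.ncard_cells_le (n * n)
    have := Set.ncard_le_ncard hcells hfin
    simp only [DagApsp.space]
    nlinarith
  · have hfin := (DagApsp.ncard_cells_le (n * n)).1.subset hcells
    have hinj : Function.Injective fun p : Fin n × Fin n =>
        DagApsp.Cell.int 3 (p.1 * n + p.2) := by
      rintro ⟨u, v⟩ ⟨u', v'⟩ h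
      simp only [DagApsp.Cell.int.injEq, true_and] at h
      obtain ⟨rfl, rfl⟩ := DagApsp.idx_inj.1 h
      rfl
    -- The adjacency matrix starts with zeros and ends with entries `1` or `e + 2`, so each of its
    -- `n²` cells has been accessed.
    have hsub : Set.range (fun p : Fin n × Fin n => DagApsp.Cell.int 3 (p.1 * n + p.2)) ⊆
        {c | ∃ i < T, DagApsp.Config.cell
          (DagApsp.run DagApsp.apsp (DagApsp.inputState G) i) = some c} := by
      rintro _ ⟨⟨u, v⟩, rfl⟩
      refine DagApsp.exists_cell_of_iarr_ne _ _ T 3 _ ?_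
      have h0 : (DagApsp.inputState G).iarr 3 (u * n + v) = 0 := by
        simp [DagApsp.inputState]
      rw [h0]
      by_cases he : ∃ e, G.src e = u ∧ G.tgt e = v
      · obtain ⟨e, rfl, rfl⟩ := he
        rw [hstatic.adj_edge]; omega
      · push Not at he
        rw [hstatic.adj_none u v he]; omega
    have hle := Set.ncard_le_ncard hsub hfin
    rw [← Set.image_univ, Set.ncard_image_of_injective _ hinj, Set.ncard_univ] at hle
    simp only [Nat.card_eq_fintype_card, Fintype.card_prod, Fintype.card_fin] at hle
    simp only [DagApsp.space]
    nlinarith
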